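/- Let $\ell\ge 1$, $V=\mathbb{C}^\ell$, $R=\mathbb{C}[x_1,\dots,x_\ell]$, and let $\mathcal{A}$ be a central arrangement of $n$ distinct hyperplanes $H=\ker\alpha_H$ in $V$ whose linear forms $\alpha_H$ span $V^*$; put $f=\prod_H\alpha_H$. Let $\Omega^p(\mathcal{A})$ be the $R$-module of rational $p$-forms $\omega\in\frac1f\Omega^p_V$ (where $\Omega^p_V$ are the polynomial $p$-forms) such that $\frac{d\alpha_H}{\alpha_H}\wedge\omega\in\frac1f\Omega^{p+1}_V$ for all $H$, graded so that each $dx_i$ has degree $1$. Let $\chi=\sum_i x_i\partial_i$ and $\Omega^p_0(\mathcal{A})=\ker\iota_\chi\subseteq\Omega^p(\mathcal{A})$. For $\lambda\in\mathbb{C}^{\mathcal{A}}$ put $|\lambda|=\sum_H\lambda_H$ and $\omega_\lambda=\sum_H\lambda_H\,d\alpha_H/\alpha_H$. If $|\lambda|=0$, then $(\Omega^\bullet_0(\mathcal{A}),\omega_\lambda)$ denotes the complex with differential $\omega\mapsto\omega_\lambda\wedge\omega$. Let $D(\mathcal{A})$ be the module of derivations $\delta$ of $R$ over $\mathbb{C}$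 with $\delta(\alpha_H)\in\alpha_HR$ for all $H$, let $D^0(\mathcal{A})=D(\mathcal{A})/R\chi$, and for $|\lambda|=0$ let $I_{0,\lambda}(\mathcal{A})\subseteq R$ be the ideal of all values $\langle\delta,\omega_\lambda\rangle=\sum_H\lambda_H\,\delta(\alpha_H)/\alpha_H$, $\delta\in D^0(\mathcal{A})$. Assume that $\mathcal{A}$ is almost tame, i.e. $\operatorname{pd}_R\Omega^p(\mathcal{A})\le p+1$ for $p=1,\dots,\ell$. Then for generic $\lambda$ with $|\lambda|=0$, $$H^p(\Omega^\bullet_0(\mathcal{A}),\omega_\lambda)\cong\begin{cases}0&\text{for }p\ne\ell-1,\\ (R/I_{0,\lambda}(\mathcal{A}))(n-\ell)&\text{for }p=\ell-1,\end{cases}$$ as graded $R$-modules, where $M(k)_j=M_{j+k}$. Here "generic" means: there is a Zariski-open set $Y\subseteq\mathbb{C}^{\mathcal{A}}$, meeting the hyperplane $\{|\lambda|=0\}$, such that for every $\lambda\in Y$ with $|\lambda|=0$ the master function $\Phi_\lambda=\prod_H\alpha_H^{\lambda_H}$ has only isolated, nondegenerate critical points on the complement of the arrangement in $\mathbb{P}V$,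 and the displayed isomorphisms hold. -/

import Mathlib

noncomputable section

namespace LogForms

/-- The coordinate ring `R = ℂ[x₁, …, x_ℓ]` of `V = ℂ^ℓ`. -/
abbrev Poly (ℓ : ℕ) : Type := MvPolynomial (Fin ℓ) ℂ

/-- The field of rational functions on `V`. -/
abbrev RatFun (ℓ : ℕ) : Type := FractionRing (Poly ℓ)

/-- The algebra of rational differential forms on `V`: the exterior algebra over `ℂ(x₁, …, x_ℓ)`
on the vector space with basis `dx₁, …, dx_ℓ` (the standard basis of `Fin ℓ → RatFun ℓ`). -/
abbrev RatForm (ℓ : ℕ) : Type := ExteriorAlgebra (RatFun ℓ) (Fin ℓ → RatFun ℓ)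

/-- The inclusion of the polynomial forms `⋀_R (⨁ R dx_i)` into the rational forms. -/
def polyIncl (ℓ : ℕ) :
    ExteriorAlgebra (Poly ℓ) (Fin ℓ → Poly ℓ) →ₐ[Poly ℓ] RatForm ℓ :=
  ExteriorAlgebra.lift (Poly ℓ)
    ⟨((ExteriorAlgebra.ι (RatFun ℓ)).restrictScalars (Poly ℓ)).comp
      ((Algebra.linearMap (Poly ℓ) (RatFun ℓ)).compLeft (Fin ℓ)),
      fun _ => ExteriorAlgebra.ι_sq_zero _⟩

/-- The polynomial `p`-forms `Ω^p_V`, as a submodule of the rational forms. -/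
def polyForms (ℓ p : ℕ) : Submodule (Poly ℓ) (RatForm ℓ) :=
  (⋀[Poly ℓ]^p (Fin ℓ → Poly ℓ)).map (polyIncl ℓ).toLinearMap

/-- `g` is homogeneous of degree `k`; for `k < 0` this means `g = 0`. -/
def IsHomog {ℓ : ℕ} (g : Poly ℓ) (k : ℤ) : Prop :=
  ∀ d : Fin ℓ →₀ ℕ, g.coeff d ≠ 0 → ((d.degree : ℕ) : ℤ) = k

/-- The polynomial `p`-forms that are homogeneous of degree `k`, where every `dx_i` has degree `1`
(so that `d` has degree `0`): sums of `g dx_{s 0} ∧ ⋯ ∧ dx_{s (p-1)}` with `deg g + p = k`. -/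
def polyFormsDeg (ℓ p : ℕ) (k : ℤ) : Submodule ℂ (RatForm ℓ) :=
  Submodule.span ℂ {η | ∃ (g : Poly ℓ) (s : Fin p → Fin ℓ), IsHomog g (k - p) ∧
    η = g • ExteriorAlgebra.ιMulti (RatFun ℓ) p (fun i => Pi.single (s i) 1)}

/-- The contraction `ι_δ` of rational forms with a polynomial vector field `δ`; it is the
antiderivation with `ι_δ(dx_i) = δ(x_i)`. -/
def contract {ℓ : ℕ} (δ : Derivation ℂ (Poly ℓ) (Poly ℓ)) : RatForm ℓ →ₗ[RatFun ℓ] RatForm ℓ :=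
  CliffordAlgebra.contractLeft
    (∑ i, algebraMap (Poly ℓ) (RatFun ℓ) (δ (MvPolynomial.X i)) •
      (LinearMap.proj i : (Fin ℓ → RatFun ℓ) →ₗ[RatFun ℓ] RatFun ℓ))

/-- The Euler vector field `χ = ∑ x_i ∂_i`. -/
def euler (ℓ : ℕ) : Derivation ℂ (Poly ℓ) (Poly ℓ) :=
  MvPolynomial.mkDerivation ℂ MvPolynomial.X

/-- A central simple arrangement of `n` hyperplanes in `ℂ^ℓ`, given by the coefficients of the
defining linear forms `α_H`: these are nonzero and define pairwise distinct hyperplanes. -/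
structure Arrangement (ℓ n : ℕ) where
  coeff : Fin n → Fin ℓ → ℂ
  coeff_ne_zero : ∀ H, coeff H ≠ 0
  indep : ∀ H H', H ≠ H' → LinearIndependent ℂ ![coeff H, coeff H']

namespace Arrangement

variable {ℓ n : ℕ} (A : Arrangement ℓ n)

/-- The linear forms `α_H` span `V*`, i.e. `ℓ` of them are coordinates on `V`. -/
def Essential : Prop := Submodule.span ℂ (Set.range A.coeff) = ⊤

/-- The value of `α_H` at a vector. -/
def eval (H : Fin n) (v : Fin ℓ → ℂ) : ℂ := ∑ i, A.coeff H i * v i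

/-- The linear form `α_H` as an element of `R`. -/
def form (H : Fin n) : Poly ℓ := ∑ i, MvPolynomial.C (A.coeff H i) * MvPolynomial.X i

/-- The defining equation `f = ∏ α_H`. -/
def defEq : Poly ℓ := ∏ H, A.form H

/-- `dα_H`, as a vector in the span of the `dx_i`. -/
def dvec (H : Fin n) : Fin ℓ → RatFun ℓ := fun i => algebraMap ℂ (RatFun ℓ) (A.coeff H i)

/-- The form `dα_H / α_H`. -/
def dlog (H : Fin n) : RatForm ℓ :=
  ExteriorAlgebra.ι (RatFun ℓ) ((algebraMap (Poly ℓ) (RatFun ℓ) (A.form H))⁻¹ • A.dvec H)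

/-- `Ω^p(A)`: the forms `ω ∈ (1/f) Ω^p_V` with `(dα_H / α_H) ∧ ω ∈ (1/f) Ω^{p+1}_V` for all `H`. -/
def logForms (p : ℕ) : Submodule (Poly ℓ) (RatForm ℓ) where
  carrier := {ω | A.defEq • ω ∈ polyForms ℓ p ∧
    ∀ H, A.defEq • (A.dlog H * ω) ∈ polyForms ℓ (p + 1)}
  zero_mem' := by simp
  add_mem' := by
    rintro a b ⟨ha, ha'⟩ ⟨hb, hb'⟩
    refine ⟨?_, fun H => ?_⟩
    · rw [smul_add]; exact add_mem ha hb
    · rw [mul_add, smul_add]; exact add_mem (ha' H) (hb' H)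
  smul_mem' := by
    rintro c a ⟨ha, ha'⟩
    refine ⟨?_, fun H => ?_⟩
    · rw [smul_comm]; exact Submodule.smul_mem _ _ ha
    · rw [mul_smul_comm, smul_comm]; exact Submodule.smul_mem _ _ (ha' H)

/-- `Ω^p_0(A)`, the kernel of `ι_χ` on `Ω^p(A)`. -/
def relForms (p : ℕ) : Submodule (Poly ℓ) (RatForm ℓ) :=
  A.logForms p ⊓ LinearMap.ker ((contract (euler ℓ)).restrictScalars (Poly ℓ))

/-- `A` is almost tame: `pd_R Ω^p(A) ≤ p + 1` for `p = 1, …, ℓ`. -/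
def AlmostTame : Prop :=
  ∀ p : ℕ, 1 ≤ p → p ≤ ℓ →
    CategoryTheory.HasProjectiveDimensionLE (ModuleCat.of (Poly ℓ) (A.logForms p)) (p + 1)

/-- `ω_λ = ∑ λ_H dα_H / α_H`. -/
def omega (lam : Fin n → ℂ) : RatForm ℓ := ∑ H, lam H • A.dlog H

lemma form_ne_zero (H : Fin n) : A.form H ≠ 0 := by
  intro h
  apply A.coeff_ne_zero H
  funext i
  have := congrArg (MvPolynomial.coeff (Finsupp.single i 1)) h
  simpa [form, MvPolynomial.coeff_sum, MvPolynomial.coeff_C_mul, MvPolynomial.coeff_X,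
    Finsupp.single_left_inj] using this

lemma totalDegree_form_le (H : Fin n) : (A.form H).totalDegree ≤ 1 := by
  refine MvPolynomial.totalDegree_finsetSum_le fun i _ => ?_
  refine (MvPolynomial.totalDegree_mul _ _).trans ?_
  simp

lemma isRelPrime_form {H H' : Fin n} (hne : H ≠ H') : IsRelPrime (A.form H) (A.form H') := by
  rintro d ⟨a, ha⟩ ⟨b, hb⟩
  have hd : d ≠ 0 := by rintro rfl; exact A.form_ne_zero H (by simpa using ha)
  have ha0 : a ≠ 0 := by rintro rfl; exact A.form_ne_zero H (by simpa using ha)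
  have hb0 : b ≠ 0 := by rintro rfl; exact A.form_ne_zero H' (by simpa using hb)
  have h1 := A.totalDegree_form_le H
  have h2 := A.totalDegree_form_le H'
  rw [ha, MvPolynomial.totalDegree_mul_of_isDomain hd ha0] at h1
  rw [hb, MvPolynomial.totalDegree_mul_of_isDomain hd hb0] at h2
  by_cases h0 : d.totalDegree = 0
  · rw [MvPolynomial.totalDegree_eq_zero_iff_eq_C] at h0
    rw [h0]
    refine (IsUnit.mk0 _ fun h => hd ?_).map MvPolynomial.C
    rw [h0, h, map_zero]
  · exfalso
    have ha' := MvPolynomial.totalDegree_eq_zero_iff_eq_C.mp (show a.totalDegree = 0 by omega)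
    have hb' := MvPolynomial.totalDegree_eq_zero_iff_eq_C.mp (show b.totalDegree = 0 by omega)
    have key : MvPolynomial.C (b.coeff 0) * A.form H = MvPolynomial.C (a.coeff 0) * A.form H' := by
      rw [ha, hb, ← ha', ← hb']; ring
    have := LinearIndependent.pair_iff.mp (A.indep H H' hne) (b.coeff 0) (-(a.coeff 0)) (by
      funext i
      have := congrArg (MvPolynomial.coeff (Finsupp.single i 1)) key
      simp [form, MvPolynomial.coeff_sum, MvPolynomial.coeff_C_mul, MvPolynomial.coeff_X,
        Finsupp.single_left_inj] at this
      simp [this])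
    apply hb0
    rw [hb', this.1, map_zero]

lemma polyIncl_ι (m : Fin ℓ → Poly ℓ) : polyIncl ℓ (ExteriorAlgebra.ι _ m) =
    ExteriorAlgebra.ι (RatFun ℓ) (fun i => algebraMap (Poly ℓ) (RatFun ℓ) (m i)) := by
  exact ExteriorAlgebra.lift_ι_apply _ _ _ _

lemma polyIncl_injective (ℓ : ℕ) : Function.Injective (polyIncl ℓ) := by
  let bR := (Pi.basisFun (Poly ℓ) (Fin ℓ)).ExteriorAlgebra
  let bK := (Pi.basisFun (RatFun ℓ) (Fin ℓ)).ExteriorAlgebra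
  have hb : ∀ s, (polyIncl ℓ).toLinearMap (bR s) = bK s := by
    intro s
    simp only [bR, bK, ExteriorAlgebra.basis_apply, ExteriorAlgebra.ιMulti_family,
      ExteriorAlgebra.ιMulti_apply, AlgHom.toLinearMap_apply, map_list_prod, List.map_ofFn]
    congr 2
    funext i
    simp only [Function.comp_apply, polyIncl_ι]
    congr 1
    funext j
    simp [Pi.single_apply, apply_ite]
  have hli : LinearIndependent (Poly ℓ) ((polyIncl ℓ).toLinearMap ∘ bR) := by
    rw [show (polyIncl ℓ).toLinearMap ∘ bR = bK from funext hb]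
    exact bK.linearIndependent.restrict_scalars' (Poly ℓ)
  refine (injective_iff_map_eq_zero (polyIncl ℓ)).mpr fun x hx => ?_
  have h0 := linearIndependent_iff.mp hli (bR.repr x) (by
    rw [← Finsupp.apply_linearCombination, Module.Basis.linearCombination_repr]
    exact hx)
  simpa using h0


/-- A form `η / (α α')` for which both `η / α` and `η / α'` are polynomial is itself polynomial,
when `α` and `α'` are coprime. -/
lemma mem_polyForms_of_isRelPrime {p : ℕ} {a b : Poly ℓ} (hab : IsRelPrime a b) (ha : a ≠ 0)
    {x : RatForm ℓ} (hxa : a • x ∈ polyForms ℓ p) (hxb : b • x ∈ polyForms ℓ p) :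
    x ∈ polyForms ℓ p := by
  obtain ⟨u, hu, hua⟩ := hxa
  obtain ⟨w, hw, hwb⟩ := hxb
  simp only [AlgHom.toLinearMap_apply] at hua hwb
  have huw : b • u = a • w := by
    apply polyIncl_injective
    rw [map_smul, map_smul, hua, hwb, smul_comm]
  let B := (Pi.basisFun (Poly ℓ) (Fin ℓ)).exteriorPower p
  have hco : ∀ s, a ∣ B.repr ⟨u, hu⟩ s := by
    intro s
    refine hab.dvd_of_dvd_mul_left ⟨B.repr ⟨w, hw⟩ s, ?_⟩
    have : b • (⟨u, hu⟩ : ⋀[Poly ℓ]^p (Fin ℓ → Poly ℓ)) = a • ⟨w, hw⟩ := Subtype.ext huw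
    have h1 := congrArg B.repr this
    rw [map_smul, map_smul] at h1
    exact DFunLike.congr_fun h1 s
  choose c hc using hco
  have hu' : u = a • ((∑ s, c s • B s : ⋀[Poly ℓ]^p (Fin ℓ → Poly ℓ)) :
      ExteriorAlgebra (Poly ℓ) (Fin ℓ → Poly ℓ)) := by
    have h1 := B.sum_repr ⟨u, hu⟩
    have h2 : (⟨u, hu⟩ : ⋀[Poly ℓ]^p (Fin ℓ → Poly ℓ)) = a • ∑ s, c s • B s := by
      rw [← h1, Finset.smul_sum]
      exact Finset.sum_congr rfl fun s _ => by rw [hc s, mul_smul]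
    exact congrArg Subtype.val h2
  refine ⟨_, (∑ s, c s • B s : ⋀[Poly ℓ]^p (Fin ℓ → Poly ℓ)).2, ?_⟩
  have h3 : a • (polyIncl ℓ ((∑ s, c s • B s : ⋀[Poly ℓ]^p (Fin ℓ → Poly ℓ)) :
      ExteriorAlgebra (Poly ℓ) (Fin ℓ → Poly ℓ)) - x) = 0 := by
    rw [smul_sub, ← hua, ← map_smul, ← hu', sub_self]
  rw [← algebraMap_smul (RatFun ℓ) a] at h3
  have h4 : algebraMap (Poly ℓ) (RatFun ℓ) a ≠ 0 := by simpa using ha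
  exact sub_eq_zero.mp ((smul_eq_zero_iff_right h4).mp h3)

lemma dvec_mul_mem_polyForms {p : ℕ} {x : RatForm ℓ} (H : Fin n) (hx : x ∈ polyForms ℓ p) :
    ExteriorAlgebra.ι (RatFun ℓ) (A.dvec H) * x ∈ polyForms ℓ (p + 1) := by
  obtain ⟨u, hu, rfl⟩ := hx
  refine ⟨ExteriorAlgebra.ι _ (fun i => MvPolynomial.C (A.coeff H i)) * u, ?_, ?_⟩
  · rw [SetLike.mem_coe, add_comm p 1]
    refine SetLike.mul_mem_graded (A := fun i : ℕ => ⋀[Poly ℓ]^i (Fin ℓ → Poly ℓ)) ?_ hu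
    change _ ∈ LinearMap.range (ExteriorAlgebra.ι (Poly ℓ)) ^ 1
    rw [pow_one]
    exact LinearMap.mem_range_self _ _
  · rw [AlgHom.toLinearMap_apply, map_mul, polyIncl_ι]
    rfl

lemma form_smul_dlog (H : Fin n) :
    A.form H • A.dlog H = ExteriorAlgebra.ι (RatFun ℓ) (A.dvec H) := by
  rw [dlog, map_smul, ← algebraMap_smul (RatFun ℓ) (A.form H), smul_smul, mul_inv_cancel₀, one_smul]
  simpa using A.form_ne_zero H

lemma dlog_mul_self (H : Fin n) : A.dlog H * A.dlog H = 0 := ExteriorAlgebra.ι_sq_zero _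

lemma dlog_mul_dlog (H H' : Fin n) : A.dlog H * A.dlog H' = - (A.dlog H' * A.dlog H) :=
  eq_neg_of_add_eq_zero_left (ExteriorAlgebra.ι_add_mul_swap _ _)

lemma dlog_mul_mem_logForms {p : ℕ} {w : RatForm ℓ} (H : Fin n) (hw : w ∈ A.logForms p) :
    A.dlog H * w ∈ A.logForms (p + 1) := by
  refine ⟨hw.2 H, fun H' => ?_⟩
  by_cases hne : H' = H
  · subst hne
    rw [← mul_assoc, dlog_mul_self, zero_mul, smul_zero]
    exact zero_mem _
  · refine mem_polyForms_of_isRelPrime (A.isRelPrime_form hne) (A.form_ne_zero H') ?_ ?_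
    · rw [smul_comm, ← smul_mul_assoc, form_smul_dlog, ← mul_smul_comm]
      exact A.dvec_mul_mem_polyForms H' (hw.2 H)
    · rw [← mul_assoc, dlog_mul_dlog, neg_mul, mul_assoc, smul_neg, smul_neg, smul_comm,
        ← smul_mul_assoc, form_smul_dlog, ← mul_smul_comm]
      exact neg_mem (A.dvec_mul_mem_polyForms H (hw.2 H'))

lemma omega_mul_mem_logForms (lam : Fin n → ℂ) {p : ℕ} {w : RatForm ℓ} (hw : w ∈ A.logForms p) :
    A.omega lam * w ∈ A.logForms (p + 1) := by
  rw [omega, Finset.sum_mul]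
  refine sum_mem fun H _ => ?_
  rw [smul_mul_assoc, ← algebraMap_smul (Poly ℓ) (lam H)]
  exact Submodule.smul_mem _ _ (A.dlog_mul_mem_logForms H hw)

lemma omega_eq (lam : Fin n → ℂ) : A.omega lam = ExteriorAlgebra.ι (RatFun ℓ)
    (∑ H, lam H • (algebraMap (Poly ℓ) (RatFun ℓ) (A.form H))⁻¹ • A.dvec H) := by
  simp only [omega, dlog, map_sum]
  refine Finset.sum_congr rfl fun H _ => ?_
  rw [← algebraMap_smul (RatFun ℓ) (lam H), ← algebraMap_smul (RatFun ℓ) (lam H), ← map_smul]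

lemma omega_mul_self (lam : Fin n → ℂ) : A.omega lam * A.omega lam = 0 := by
  rw [omega_eq]; exact ExteriorAlgebra.ι_sq_zero _

lemma contract_dlog (δ : Derivation ℂ (Poly ℓ) (Poly ℓ)) (H : Fin n) :
    contract δ (A.dlog H) = algebraMap (RatFun ℓ) (RatForm ℓ)
      (algebraMap (Poly ℓ) (RatFun ℓ) (δ (A.form H)) /
        algebraMap (Poly ℓ) (RatFun ℓ) (A.form H)) := by
  have h : algebraMap (Poly ℓ) (RatFun ℓ) (δ (A.form H)) =
      ∑ i, algebraMap ℂ (RatFun ℓ) (A.coeff H i) *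
        algebraMap (Poly ℓ) (RatFun ℓ) (δ (MvPolynomial.X i)) := by
    simp [form, IsScalarTower.algebraMap_apply ℂ (Poly ℓ) (RatFun ℓ), MvPolynomial.algebraMap_eq]
  rw [contract, dlog, CliffordAlgebra.contractLeft_ι, h]
  congr 1
  simp [dvec, div_eq_inv_mul, Finset.mul_sum]
  exact Finset.sum_congr rfl fun i _ => by rw [Algebra.smul_def]; ring

lemma contract_omega (δ : Derivation ℂ (Poly ℓ) (Poly ℓ)) (lam : Fin n → ℂ) :
    contract δ (A.omega lam) = algebraMap (RatFun ℓ) (RatForm ℓ)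
      (∑ H, lam H • (algebraMap (Poly ℓ) (RatFun ℓ) (δ (A.form H)) /
        algebraMap (Poly ℓ) (RatFun ℓ) (A.form H))) := by
  rw [omega, map_sum, map_sum]
  refine Finset.sum_congr rfl fun H _ => ?_
  rw [← algebraMap_smul (RatFun ℓ) (lam H), map_smul, contract_dlog,
    ← algebraMap_smul (RatFun ℓ) (lam H), smul_eq_mul, map_mul, Algebra.smul_def]

lemma euler_form (H : Fin n) : euler ℓ (A.form H) = A.form H := by
  simp [form, euler, MvPolynomial.mkDerivation_X]

/-- `ι_χ(ω_λ) = |λ|`. -/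
lemma contract_euler_omega (lam : Fin n → ℂ) :
    contract (euler ℓ) (A.omega lam) = algebraMap ℂ (RatForm ℓ) (∑ H, lam H) := by
  rw [contract_omega, IsScalarTower.algebraMap_apply ℂ (RatFun ℓ) (RatForm ℓ),
    map_sum (algebraMap ℂ (RatFun ℓ))]
  congr 1
  refine Finset.sum_congr rfl fun H _ => ?_
  rw [euler_form, div_self (by simpa using A.form_ne_zero H), Algebra.smul_def, mul_one]

lemma omega_mul_mem_relForms {lam : Fin n → ℂ} (hlam : ∑ H, lam H = 0) {p : ℕ} {w : RatForm ℓ}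
    (hw : w ∈ A.relForms p) : A.omega lam * w ∈ A.relForms (p + 1) := by
  refine ⟨A.omega_mul_mem_logForms lam hw.1, ?_⟩
  have h1 : contract (euler ℓ) w = 0 := hw.2
  have h2 := A.contract_euler_omega lam
  rw [hlam, map_zero, omega_eq, contract, CliffordAlgebra.contractLeft_ι] at h2
  change contract (euler ℓ) (A.omega lam * w) = 0
  have h3 := (algebraMap (RatFun ℓ) (RatForm ℓ)).injective (h2.trans (map_zero (algebraMap (RatFun ℓ) (RatForm ℓ))).symm)
  rw [omega_eq, contract, CliffordAlgebra.contractLeft_ι_mul, h3, zero_smul, zero_sub,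
    neg_eq_zero]
  rw [contract] at h1
  rw [h1, mul_zero]

/-- The cocycles in degree `p` of the complex `(Ω^•_0(A), ω_λ)`, whose differential
`Ω^p_0(A) → Ω^{p+1}_0(A)` is `w ↦ ω_λ ∧ w`. -/
def cocycles (lam : Fin n → ℂ) (p : ℕ) : Submodule (Poly ℓ) (RatForm ℓ) :=
  A.relForms p ⊓ LinearMap.ker (LinearMap.mulLeft (Poly ℓ) (A.omega lam))

/-- The coboundaries in degree `p` of the complex `(Ω^•_0(A), ω_λ)`. -/
def coboundaries (lam : Fin n → ℂ) : ℕ → Submodule (Poly ℓ) (RatForm ℓ)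
  | 0 => ⊥
  | p + 1 => (A.relForms p).map (LinearMap.mulLeft (Poly ℓ) (A.omega lam))

/-- For `|λ| = 0`, `(Ω^•_0(A), ω_λ)` is a complex. -/
lemma coboundaries_le_cocycles {lam : Fin n → ℂ} (hlam : ∑ H, lam H = 0) (p : ℕ) :
    A.coboundaries lam p ≤ A.cocycles lam p := by
  cases p with
  | zero => exact bot_le
  | succ p =>
    rintro _ ⟨w, hw, rfl⟩
    refine ⟨A.omega_mul_mem_relForms hlam hw, ?_⟩
    change A.omega lam * (A.omega lam * w) = 0
    rw [← mul_assoc, omega_mul_self, zero_mul]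

/-- The cohomology `H^p(Ω^•_0(A), ω_λ)`, for `|λ| = 0`. -/
abbrev Cohomology (lam : Fin n → ℂ) (p : ℕ) : Type :=
  A.cocycles lam p ⧸ (A.coboundaries lam p).submoduleOf (A.cocycles lam p)

/-- A rational `p`-form with denominator `f` is homogeneous of degree `j` if `f` times it is a
polynomial `p`-form of degree `j + n`, where `n = deg f`. So `dα_H / α_H` has degree `0`. -/
def IsHomogForm (p : ℕ) (w : RatForm ℓ) (j : ℤ) : Prop :=
  A.defEq • w ∈ polyFormsDeg ℓ p (j + n)

/-- The degree `j` part of `H^p(Ω^•_0(A), ω_λ)`: the classes of the homogeneous cocycles of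
degree `j`. -/
def cohomologyDeg (lam : Fin n → ℂ) (p : ℕ) (j : ℤ) : Set (A.Cohomology lam p) :=
  {c | ∃ z : A.cocycles lam p, A.IsHomogForm p z j ∧ Submodule.Quotient.mk z = c}

/-- `D(A)`: the polynomial vector fields `δ` with `δ(α_H) ∈ α_H R` for all `H`. -/
def logDer : Submodule (Poly ℓ) (Derivation ℂ (Poly ℓ) (Poly ℓ)) where
  carrier := {δ | ∀ H, A.form H ∣ δ (A.form H)}
  zero_mem' := fun H => by simp
  add_mem' := fun ha hb H => dvd_add (ha H) (hb H)
  smul_mem' := fun c _ ha H => (ha H).mul_left c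

/-- The ideal `I_{0,λ}(A) = ⟨D^0(A), ω_λ⟩` of `R` formed by the values `⟨δ, ω_λ⟩ = ι_δ(ω_λ)`.
Here `D^0(A) = D(A) / Rχ`, and for `|λ| = 0` the pairing with `ω_λ` is well defined on this
quotient because `ι_χ(ω_λ) = |λ|`; so `δ` may range over `D(A)`. -/
def ideal (lam : Fin n → ℂ) : Ideal (Poly ℓ) :=
  Ideal.span {r | ∃ δ ∈ A.logDer, contract δ (A.omega lam) = algebraMap (Poly ℓ) (RatForm ℓ) r}

/-- `v` lies in the complement of the arrangement and is a zero of `ω_λ = d log Φ_λ`, where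
`Φ_λ = ∏ α_H ^ λ_H` is the master function. For `|λ| = 0`, `Φ_λ` is a (multivalued) function on
the complement of the projectivized arrangement in `ℙV`, and these `v` are the representatives of
its critical points. -/
def IsCritical (lam : Fin n → ℂ) (v : Fin ℓ → ℂ) : Prop :=
  (∀ H, A.eval H v ≠ 0) ∧ ∀ a, ∑ H, lam H * (A.eval H a / A.eval H v) = 0

/-- The point of `ℙV` represented by `v` is isolated among the critical points. -/
def IsIsolatedCritical (lam : Fin n → ℂ) (v : Fin ℓ → ℂ) : Prop :=
  ∀ᶠ w in nhds v, A.IsCritical lam w → w ∈ Submodule.span ℂ {v}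

/-- The Hessian `(a, b) ↦ -∑ λ_H α_H(a) α_H(b) / α_H(v)²` of `log Φ_λ` at a critical point `v` is
nondegenerate on the tangent space `V / ℂv` of `ℙV`. -/
def IsNondegenerateAt (lam : Fin n → ℂ) (v : Fin ℓ → ℂ) : Prop :=
  ∀ a, (∀ b, ∑ H, lam H * (A.eval H a * A.eval H b / A.eval H v ^ 2) = 0) →
    a ∈ Submodule.span ℂ {v}

end Arrangement

/-- The degree `k` part of `R / I`: the classes of the homogeneous polynomials of degree `k`. -/
def quotDeg {ℓ : ℕ} (I : Ideal (Poly ℓ)) (k : ℤ) : Set (Poly ℓ ⧸ I) :=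
  {x | ∃ g : Poly ℓ, IsHomog g k ∧ Ideal.Quotient.mk I g = x}

/-- Zariski-open subsets of `ℂ^n`: the complements of the zero sets of families of polynomials. -/
def IsZariskiOpen {n : ℕ} (Y : Set (Fin n → ℂ)) : Prop :=
  ∃ J : Set (MvPolynomial (Fin n) ℂ), Y = {lam | ∃ g ∈ J, MvPolynomial.eval lam g ≠ 0}

end LogForms

end

/-! In degree $\ell-1$ everything is explicit. `relForms` is there free on `topForm`, of degree
$\ell-n$, and is zero one degree higher. Contracting the volume form identifies logarithmic fields
with $f$ times logarithmic $(\ell-1)$-forms, so the coboundaries are exactly $I_{0,\lambda}$ times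
`topForm` (`smul_topForm_mem_coboundaries_iff`).

Below that degree, the cohomology is first shown to be supported at the origin. By
$\iota_\delta(\omega_\lambda\wedge z)=\langle\delta,\omega_\lambda\rangle
z-\omega_\lambda\wedge\iota_\delta z$ it is killed by $I_{0,\lambda}$. At $v\ne 0$ on the
arrangement, a multiple of the Euler field centred at $v$ gives an element of this ideal with value
a nonzero multiple of $\sum_{H\ni v}\lambda_H$; at a noncritical point of the complement some
$f\partial_i$ works. At a nondegenerate critical point, adding $h\,d\alpha_H/\alpha_H$ to
$\omega_\lambda$, with $h$ a coordinate transverse to the critical line, makes the local complex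
exact below degree $\ell$ (`perturbed_exact`). Hence cocycles below degree $\ell-1$ are locally $h$
times cocycles modulo coboundaries, and Nakayama applies.

Support at the origin is then played off against depth. $\Omega^p_0$ is a direct summand of
$\Omega^p(\mathcal A)$, so tameness gives $\operatorname{Ext}^j(R/J,\Omega^p_0)=0$ for $j+p<\ell-1$
when $J$ contains powers of all coordinates (`extVanishes_relForms`), and the acyclicity lemma
`mem_boundaries_of_extVanishes` kills the cohomology.

What must be generic is that no proper nonempty partial sum of $\lambda$ vanishes and that critical
points are nondegenerate. The latter is generic smoothness in algebraic form: if degenerate critical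
points lay over a generic $\lambda$, derivations in the parameters would extend to a field
containing such a point, and differentiating the critical equations gives a contradiction
(`IsDegenerateSolution.false_of_derivation`). -/

noncomputable section

/-! ### Ext vanishing from depth and projective dimension. -/

open CategoryTheory Abelian in
/-- `Ext^j(N, X) = 0` for modules `N`, `X` over a commutative ring. -/
def ExtVanishes {R : Type} [CommRing R] (N X : Type) [AddCommGroup N] [Module R N]
    [AddCommGroup X] [Module R X] (j : ℕ) : Prop :=
  Subsingleton (Ext.{0} (ModuleCat.of R N) (ModuleCat.of R X) j)

namespace ExtVanishes

open CategoryTheory Abelian RingTheory.Sequence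

variable {R : Type} [CommRing R] {N X Y Z : Type} [AddCommGroup N] [Module R N]
  [AddCommGroup X] [Module R X] [AddCommGroup Y] [Module R Y] [AddCommGroup Z] [Module R Z]

lemma of_exact {f : X →ₗ[R] Y} {g : Y →ₗ[R] Z} (hf : Function.Injective f)
    (hfg : Function.Exact f g) (hg : Function.Surjective g) {j : ℕ}
    (hY : ExtVanishes (R := R) N Y j) (hX : ExtVanishes (R := R) N X (j + 1)) :
    ExtVanishes (R := R) N Z j := by
  have hS : (ModuleCat.shortComplexOfCompEqZero f g hfg.linearMap_comp_eq_zero).ShortExact :=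
    ModuleCat.shortComplex_shortExact _ hfg hf hg
  exact AddCommGrpCat.subsingleton_of_isZero <| ShortComplex.Exact.isZero_of_both_zeros
        ((Ext.covariant_sequence_exact₃' (ModuleCat.of R N) hS) j (j + 1) rfl)
        ((AddCommGrpCat.isZero_of_iff_subsingleton.mpr hY).eq_zero_of_src _)
        ((AddCommGrpCat.isZero_of_iff_subsingleton.mpr hX).eq_zero_of_tgt _)

/-- The identity of $X$ factors through $Y$, hence so does every class in
$\operatorname{Ext}^j(N,X)$. -/
lemma of_retract (i : X →ₗ[R] Y) (r : Y →ₗ[R] X) (h : ∀ x, r (i x) = x) {j : ℕ}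
    (hY : ExtVanishes (R := R) N Y j) : ExtVanishes (R := R) N X j := by
  unfold ExtVanishes at *
  have hcomp : ModuleCat.ofHom i ≫ ModuleCat.ofHom r = 𝟙 (ModuleCat.of R X) := by
    ext x; exact h x
  refine subsingleton_of_forall_eq 0 fun e => ?_
  have : e.comp (Ext.mk₀ (𝟙 (ModuleCat.of R X))) (add_zero j) = e := Ext.comp_mk₀_id e
  rw [← hcomp, ← Ext.mk₀_comp_mk₀, ← Ext.comp_assoc_of_third_deg_zero,
    Subsingleton.elim (e.comp (Ext.mk₀ (ModuleCat.ofHom i)) (add_zero j)) 0, Ext.zero_comp] at this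
  exact this.symm

lemma of_equiv (e : X ≃ₗ[R] Y) {j : ℕ} (hY : ExtVanishes (R := R) N Y j) :
    ExtVanishes (R := R) N X j :=
  hY.of_retract e.toLinearMap e.symm.toLinearMap e.symm_apply_apply

lemma linearMap_eq_zero (h : ExtVanishes (R := R) N X 0) (φ : N →ₗ[R] X) : φ = 0 :=
  have : Subsingleton (N →ₗ[R] X) :=
    (Ext.addEquiv₀.trans ModuleCat.homAddEquiv).symm.subsingleton_congr.mpr h
  Subsingleton.elim _ _

/-- One half of Rees' theorem: a weakly regular sequence on `X`, some powers of whose members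
kill `N`, forces the vanishing of `Ext^i(N, X)` below its length. -/
lemma of_isWeaklyRegular (rs : List R) (hX : IsWeaklyRegular X rs)
    (hN : ∀ r ∈ rs, ∃ k, r ^ k ∈ Module.annihilator R N) {i : ℕ} (hi : i < rs.length) :
    ExtVanishes (R := R) N X i := by
  induction rs generalizing X i with
  | nil => simp at hi
  | cons a rs ih =>
    rw [isWeaklyRegular_cons_iff] at hX
    simp only [List.mem_cons, forall_eq_or_imp] at hN
    obtain ⟨k, hk⟩ := hN.1
    -- Multiplication by $a$ on $\operatorname{Ext}^i(N,X)$ is injective: directly on Hom for $i=0$,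
    -- otherwise because the preceding term $\operatorname{Ext}^{i-1}(N,X/aX)$ vanishes by
    -- induction. But $a^k$ kills $N$ and so acts as zero.
    have hreg : IsSMulRegular (Ext.{0} (ModuleCat.of R N) (ModuleCat.of R X) i) a := by
      rw [← Ext.postcomp_smul_id_mono_iff]
      match i with
      | 0 =>
        rw [Ext.postcomp_smul_id_mono_iff]
        intro x y hxy
        obtain ⟨x, rfl⟩ := Ext.addEquiv₀.symm.surjective x
        obtain ⟨y, rfl⟩ := Ext.addEquiv₀.symm.surjective y
        simp only [Ext.addEquiv₀_symm_apply] at hxy ⊢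
        simp only [← Ext.mk₀_smul] at hxy
        have h2 := Ext.addEquiv₀.symm.injective hxy
        congr 1
        ext n
        exact hX.1 (congrArg (fun φ => φ.hom n) h2)
      | i + 1 =>
        exact (Ext.covariant_sequence_exact₁' (ModuleCat.of R N)
          (IsSMulRegular.smulShortComplex_shortExact (M := ModuleCat.of R X) hX.1) i (i + 1)
          rfl).mono_g ((AddCommGrpCat.isZero_of_iff_subsingleton.mpr
            (ih hX.2 hN.2 (by simpa using hi))).eq_zero_of_src _)
    have h0 := Ext.postcomp_smul_id_eq_zero_of_mem_annihilator
      (M := ModuleCat.of R X) (N := ModuleCat.of R N) hk i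
    have hm := (Ext.postcomp_smul_id_mono_iff (M := ModuleCat.of R X) (N := ModuleCat.of R N)
      (a ^ k) i).mpr (hreg.pow k)
    rw [h0] at hm
    exact AddCommGrpCat.subsingleton_of_isZero (@Limits.IsZero.of_mono_eq_zero _ _ _ _ _ _ hm rfl)

lemma of_flat [Module.Flat R X] (rs : List R) (hR : IsWeaklyRegular R rs)
    (hN : ∀ r ∈ rs, ∃ k, r ^ k ∈ Module.annihilator R N) {i : ℕ} (hi : i < rs.length) :
    ExtVanishes (R := R) N X i :=
  of_isWeaklyRegular rs (((TensorProduct.rid R X).isWeaklyRegular_congr rs).mp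
    hR.isWeaklyRegular_lTensor) hN hi

/-- Each syzygy costs one Ext degree: for a free cover with kernel $K$, $\operatorname{Ext}^i(N,X)$
sits between $\operatorname{Ext}^i$ of the free module and $\operatorname{Ext}^{i+1}(N,K)$, and $K$
has smaller projective dimension. -/
lemma of_hasProjectiveDimensionLE (rs : List R) (hR : IsWeaklyRegular R rs)
    (hN : ∀ r ∈ rs, ∃ k, r ^ k ∈ Module.annihilator R N) {d i : ℕ}
    (hd : HasProjectiveDimensionLE (ModuleCat.of R X) d) (hi : i + d < rs.length) :
    ExtVanishes (R := R) N X i := by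
  induction d generalizing X i with
  | zero =>
    have hp : Projective (ModuleCat.of R X) := (projective_iff_hasProjectiveDimensionLE_zero _).mpr hd
    have : Module.Projective R X := (IsProjective.iff_projective X).mpr hp
    exact of_flat rs hR hN hi
  | succ d ih =>
    let g : (X →₀ R) →ₗ[R] X := Finsupp.linearCombination R id
    have hg : Function.Surjective g := fun x => ⟨Finsupp.single x 1, by simp [g]⟩
    have hS := LinearMap.shortExact_shortComplexKer hg
    have hp : Projective (ModuleCat.of R (X →₀ R)) :=
      (IsProjective.iff_projective (X →₀ R)).mp inferInstance
    have hk : HasProjectiveDimensionLE (ModuleCat.of R (LinearMap.ker g)) d :=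
      hS.hasProjectiveDimensionLT_X₁ (d + 1) (hasProjectiveDimensionLT_of_ge (C := ModuleCat R)
        (ModuleCat.of R (X →₀ R)) 1 (d + 1) (by omega)) hd
    exact of_exact (f := (LinearMap.ker g).subtype) (g := g) Subtype.val_injective
      (LinearMap.exact_subtype_ker_map g) hg (of_flat rs hR hN (by omega))
      (ih hk (by omega))

end ExtVanishes

/-! ### The acyclicity lemma. -/

section Acyclicity

variable {R E : Type} [CommRing R] [AddCommGroup E] [Module R E]

/-- The boundaries of a complex of submodules of `E`. -/
def boundaries (C : ℕ → Submodule R E) (d : E →ₗ[R] E) : ℕ → Submodule R E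
  | 0 => ⊥
  | i + 1 => (C i).map d

/-- An acyclicity lemma in the style of Peskine and Szpiro. -/
theorem mem_boundaries_of_extVanishes (C : ℕ → Submodule R E) (d : E →ₗ[R] E)
    (hC : ∀ i, ∀ x ∈ C i, d x ∈ C (i + 1)) (hd : ∀ x, d (d x) = 0) (J : Ideal R) (m : ℕ)
    (hE : ∀ i j, j + i < m → ExtVanishes (R := R) (R ⧸ J) (C i) j)
    (hJ : ∀ i < m, ∀ z ∈ C i, d z = 0 → ∀ r ∈ J, r • z ∈ boundaries C d i) :
    ∀ i < m, ∀ z ∈ C i, d z = 0 → z ∈ boundaries C d i := by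
  have hB : ∀ i, boundaries C d i ≤ C i := by
    rintro (_ | i)
    · exact bot_le
    · rintro _ ⟨w, hw, rfl⟩; exact hC i w hw
  -- Since $J$ kills the class of a cocycle $z$, sending $1$ to this class defines a map $R/J\to
  -- C_i/B_i$; it must vanish.
  have key : ∀ i, i < m → ExtVanishes (R := R) (R ⧸ J) (C i ⧸ (boundaries C d i).submoduleOf (C i)) 0 →
      ∀ z ∈ C i, d z = 0 → z ∈ boundaries C d i := by
    intro i hi h z hz hdz
    let φ : (R ⧸ J) →ₗ[R] (C i ⧸ (boundaries C d i).submoduleOf (C i)) :=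
      J.liftQ ((LinearMap.toSpanSingleton R _ (Submodule.Quotient.mk ⟨z, hz⟩))) (by
        intro r hr
        rw [LinearMap.mem_ker, LinearMap.toSpanSingleton_apply, ← Submodule.Quotient.mk_smul,
          Submodule.Quotient.mk_eq_zero]
        exact hJ i hi z hz hdz r hr)
    have h1 : φ (Submodule.Quotient.mk 1) = Submodule.Quotient.mk ⟨z, hz⟩ := by
      exact (J.liftQ_apply _ 1).trans (one_smul _ _)
    rw [h.linearMap_eq_zero φ, LinearMap.zero_apply, eq_comm, Submodule.Quotient.mk_eq_zero] at h1
    exact h1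
  -- Exactness at $i$, which `key` extracts from the case $j=0$, makes $0\to C_i/B_i\to C_{i+1}\to
  -- C_{i+1}/B_{i+1}\to 0$ exact, so the vanishing for $C_i/B_i$ passes to $C_{i+1}/B_{i+1}$ with
  -- $j$ lowered by one.
  have main : ∀ i j, j + i < m →
      ExtVanishes (R := R) (R ⧸ J) (C i ⧸ (boundaries C d i).submoduleOf (C i)) j := by
    intro i
    induction i with
    | zero =>
      intro j hj
      exact (hE 0 j hj).of_equiv (Submodule.quotEquivOfEqBot _ (by
        simp [boundaries, Submodule.submoduleOf]))
    | succ i ih =>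
      intro j hj
      let g : C i →ₗ[R] C (i + 1) := d.restrict (hC i)
      have hg : ∀ x, (g x : E) = d x := fun x => rfl
      have hk : LinearMap.ker g = (boundaries C d i).submoduleOf (C i) := by
        ext x
        rw [LinearMap.mem_ker, Submodule.submoduleOf, Submodule.mem_comap, Submodule.subtype_apply]
        constructor
        · intro hx
          exact key i (by omega) (ih 0 (by omega)) x x.2 (by rw [← hg, hx]; rfl)
        · intro hx
          apply Subtype.ext
          rw [hg]
          cases i with
          | zero =>
            have h0 : (x : E) = 0 := hx
            rw [h0, map_zero]; rfl
          | succ i =>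
            obtain ⟨w, -, hw⟩ := hx
            change d w = x at hw
            rw [← hw, hd]; rfl
      have hr : LinearMap.range g = (boundaries C d (i + 1)).submoduleOf (C (i + 1)) := by
        ext x
        rw [LinearMap.mem_range, Submodule.submoduleOf, Submodule.mem_comap, Submodule.subtype_apply]
        constructor
        · rintro ⟨y, rfl⟩; exact ⟨y, y.2, rfl⟩
        · rintro ⟨y, hy, hyx⟩; exact ⟨⟨y, hy⟩, Subtype.ext hyx⟩
      let f := (LinearMap.ker g).liftQ g le_rfl
      have hf : Function.Injective f := by
        rw [← LinearMap.ker_eq_bot]; exact Submodule.ker_liftQ_eq_bot _ _ _ le_rfl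
      refine ExtVanishes.of_exact (f := f) (g := Submodule.mkQ _) hf ?_ (Submodule.mkQ_surjective _)
        (hE (i + 1) j hj) ?_
      · rw [LinearMap.exact_iff, Submodule.ker_mkQ, Submodule.range_liftQ, hr]
      · exact (ih (j + 1) (by omega)).of_equiv (Submodule.quotEquivOfEq _ _ hk)
  exact fun i hi => key i hi (main i 0 (by omega))

end Acyclicity

/-! ### Regularity of the coordinates at a point. -/

section Coordinates

open MvPolynomial RingTheory.Sequence

/-- The coordinates centred at a point form a regular sequence. -/
lemma isWeaklyRegular_X_sub_C {k : Type*} [Field k] (n : ℕ) (v : Fin n → k) :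
    IsWeaklyRegular (MvPolynomial (Fin n) k) (List.ofFn fun i => X i - C (v i)) := by
  refine ⟨fun i hi => ?_⟩
  have hi' : i < n := by simpa using hi
  set I := Ideal.ofList ((List.ofFn fun i => (X i - C (v i) : MvPolynomial (Fin n) k)).take i)
  have hmem : ∀ j : Fin n, (j : ℕ) < i → (X j - C (v j) : MvPolynomial (Fin n) k) ∈ I := by
    intro j hj
    refine Ideal.subset_span ?_
    exact List.mem_take_iff_getElem.mpr ⟨j, by simp [hj], by simp⟩
  -- Substituting the values of the first $i$ coordinates has kernel exactly $I$, so the quotient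
  -- embeds in a domain in which the next $x_i-v_i$ is nonzero.
  let φ : MvPolynomial (Fin n) k →ₐ[k] MvPolynomial (Fin n) k :=
    aeval fun j => if (j : ℕ) < i then C (v j) else X j
  have hφ : ∀ p, p - φ p ∈ I := by
    intro p
    rw [← Ideal.Quotient.eq]
    have : (Ideal.Quotient.mkₐ k I) = (Ideal.Quotient.mkₐ k I).comp φ := by
      ext j
      simp only [Ideal.Quotient.mkₐ_eq_mk, AlgHom.comp_apply, φ, aeval_X]
      split_ifs with h
      · exact Ideal.Quotient.eq.mpr (hmem j h)
      · rfl
    exact DFunLike.congr_fun this p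
  have hker : ∀ p ∈ I, φ p = 0 := by
    intro p hp
    have : I ≤ RingHom.ker φ := by
      refine Ideal.span_le.mpr ?_
      intro q hq
      obtain ⟨j, hj, rfl⟩ := List.mem_take_iff_getElem.mp hq
      simp only [List.length_ofFn, lt_min_iff] at hj
      simp [φ, hj.1, RingHom.mem_ker]
    exact this hp
  have htop : (I • ⊤ : Submodule (MvPolynomial (Fin n) k) (MvPolynomial (Fin n) k)) = I := by simp
  rw [htop, List.getElem_ofFn, isSMulRegular_iff_right_eq_zero_of_smul]
  intro x
  obtain ⟨p, rfl⟩ := Ideal.Quotient.mk_surjective x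
  intro h
  have h2 : φ ((X ⟨i, hi'⟩ - C (v ⟨i, hi'⟩)) * p) = 0 := hker _ (Ideal.Quotient.eq_zero_iff_mem.mp h)
  have h3 : φ (X ⟨i, hi'⟩ - C (v ⟨i, hi'⟩)) ≠ 0 := by
    intro h0
    have hne : (0 : Fin n →₀ ℕ) ≠ Finsupp.single ⟨i, hi'⟩ 1 := by simp [eq_comm]
    have := congrArg (MvPolynomial.coeff (Finsupp.single ⟨i, hi'⟩ 1)) h0
    simp only [map_sub, φ, aeval_X, lt_irrefl, if_false, algHom_C, MvPolynomial.algebraMap_eq,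
      coeff_sub, coeff_X, coeff_C, coeff_zero] at this
    rw [if_neg hne] at this
    simp at this
  rw [map_mul] at h2
  have h4 := (mul_eq_zero.mp h2).resolve_left h3
  have h5 := hφ p
  rw [h4, sub_zero] at h5
  exact Ideal.Quotient.eq_zero_iff_mem.mpr h5

end Coordinates

/-! ### Polynomial forms and contraction. -/

namespace LogForms

open MvPolynomial

variable {ℓ : ℕ}

instance : Algebra (Poly ℓ) (RatForm ℓ) := inferInstance
instance : Module (Poly ℓ) (RatForm ℓ) := Algebra.toModule
instance : SMul (Poly ℓ) (RatForm ℓ) := Algebra.toSMul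
instance : Algebra (RatFun ℓ) (RatForm ℓ) := inferInstance
instance : Module (RatFun ℓ) (RatForm ℓ) := Algebra.toModule
instance : SMul (RatFun ℓ) (RatForm ℓ) := Algebra.toSMul
instance : IsScalarTower (Poly ℓ) (RatFun ℓ) (RatForm ℓ) := inferInstance
instance : Module.IsTorsionFree (RatFun ℓ) (RatForm ℓ) := inferInstance

/-- The form `dx_i`. -/
def dx (i : Fin ℓ) : RatForm ℓ := ExteriorAlgebra.ι (RatFun ℓ) (Pi.single i 1)

/-- The form `dx_{s 0} ∧ ⋯ ∧ dx_{s (p-1)}`. -/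
def dxMulti {p : ℕ} (s : Fin p → Fin ℓ) : RatForm ℓ :=
  ExteriorAlgebra.ιMulti (RatFun ℓ) p (fun i => Pi.single (s i) 1)

lemma dxMulti_eq_prod {p : ℕ} (s : Fin p → Fin ℓ) :
    dxMulti s = (List.ofFn fun i => dx (s i)).prod :=
  ExteriorAlgebra.ιMulti_apply _

lemma dxMulti_cons {p : ℕ} (i : Fin ℓ) (s : Fin p → Fin ℓ) :
    dxMulti (Fin.cons i s : Fin (p + 1) → Fin ℓ) = dx i * dxMulti s := by
  simp [dxMulti_eq_prod, List.ofFn_succ]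

lemma dxMulti_eq_zero {p : ℕ} {s : Fin p → Fin ℓ} (hs : ¬ Function.Injective s) :
    dxMulti s = 0 := by
  simp only [Function.Injective, not_forall] at hs
  obtain ⟨i, j, hij, hne⟩ := hs
  exact AlternatingMap.map_eq_zero_of_eq _ _ (by rw [hij]) hne

/-- The volume form `dx_1 ∧ ⋯ ∧ dx_ℓ`. -/
def dxTop (ℓ : ℕ) : RatForm ℓ := dxMulti (id : Fin ℓ → Fin ℓ)

lemma dxMulti_perm (s : Equiv.Perm (Fin ℓ)) : dxMulti s = Equiv.Perm.sign s • dxTop ℓ :=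
  (ExteriorAlgebra.ιMulti (RatFun ℓ) ℓ).map_perm (fun i => Pi.single i 1) s

lemma dxMulti_top (s : Fin ℓ → Fin ℓ) :
    dxMulti s = 0 ∨ dxMulti s = dxTop ℓ ∨ dxMulti s = -dxTop ℓ := by
  by_cases hs : Function.Injective s
  · obtain ⟨e, rfl⟩ : ∃ e : Equiv.Perm (Fin ℓ), s = e :=
      ⟨Equiv.ofBijective s (Finite.injective_iff_bijective.mp hs), rfl⟩
    right
    rw [dxMulti_perm]
    rcases Int.units_eq_one_or (Equiv.Perm.sign e) with h | h <;> simp [h]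
  · exact Or.inl (dxMulti_eq_zero hs)

/-- All $\ell$-fold products of the $dx_i$ are $0$ or $\pm$ this form, and one of them belongs to a
basis of the exterior algebra. -/
lemma dxTop_ne_zero (ℓ : ℕ) : dxTop ℓ ≠ 0 := by
  intro h
  have h0 : ∀ s : Fin ℓ → Fin ℓ, dxMulti s = 0 := by
    intro s
    rcases dxMulti_top s with h1 | h1 | h1 <;> simp [h1, h]
  have hc : (Finset.univ : Finset (Fin ℓ)).card = ℓ := by simp
  refine (Pi.basisFun (RatFun ℓ) (Fin ℓ)).ExteriorAlgebra.ne_zero Finset.univ ?_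
  rw [ExteriorAlgebra.basis_apply_ofCard _ hc,
    ← h0 (Set.powersetCard.ofFinEmbEquiv.symm (Set.powersetCard.ofCard hc))]
  simp only [ExteriorAlgebra.ιMulti_family, dxMulti]
  congr 1
  funext i
  simp

lemma smul_right_injective_ratForm {r : Poly ℓ} (hr : r ≠ 0) :
    Function.Injective (fun x : RatForm ℓ => r • x) := by
  intro x y h
  have h3 : r • (x - y) = 0 := by rw [smul_sub, sub_eq_zero]; exact h
  rw [← algebraMap_smul (RatFun ℓ) r] at h3
  have h4 : algebraMap (Poly ℓ) (RatFun ℓ) r ≠ 0 := by simpa using hr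
  exact sub_eq_zero.mp ((smul_eq_zero_iff_right h4).mp h3)

/-- This form of $\Omega^p_V$ allows induction on $p$ by splitting off one factor $dx_i$
(`polyForms_induction`). -/
lemma polyForms_eq_pow (p : ℕ) :
    polyForms ℓ p = (Submodule.span (Poly ℓ) (Set.range (dx : Fin ℓ → RatForm ℓ))) ^ p := by
  have h : (LinearMap.range (ExteriorAlgebra.ι (Poly ℓ) (M := Fin ℓ → Poly ℓ))).map
      (polyIncl ℓ).toLinearMap = Submodule.span (Poly ℓ) (Set.range dx) := by
    rw [LinearMap.range_eq_map, ← (Pi.basisFun (Poly ℓ) (Fin ℓ)).span_eq, Submodule.map_span,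
      Submodule.map_span, ← Set.range_comp, ← Set.range_comp]
    congr 2
    funext i
    simp only [Function.comp_apply, AlgHom.toLinearMap_apply, Arrangement.polyIncl_ι, dx]
    congr 1
    funext j
    simp [Pi.single_apply, apply_ite]
  rw [← h, polyForms]
  exact Submodule.map_pow _ _ _

lemma polyForms_eq_span (p : ℕ) : polyForms ℓ p =
    Submodule.span (Poly ℓ) (Set.range (dxMulti : (Fin p → Fin ℓ) → RatForm ℓ)) := by
  rw [polyForms_eq_pow, Submodule.span_pow]
  congr 1
  ext w
  rw [Set.mem_pow]
  constructor
  · rintro ⟨g, rfl⟩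
    choose s hs using fun i => (g i).2
    refine ⟨s, ?_⟩
    rw [dxMulti_eq_prod]
    simp [hs]
  · rintro ⟨s, rfl⟩
    exact ⟨fun i => ⟨dx (s i), s i, rfl⟩, by rw [dxMulti_eq_prod]⟩

lemma dxMulti_mem {p : ℕ} (s : Fin p → Fin ℓ) : dxMulti s ∈ polyForms ℓ p := by
  rw [polyForms_eq_span]; exact Submodule.subset_span ⟨s, rfl⟩

lemma dxTop_mem (ℓ : ℕ) : dxTop ℓ ∈ polyForms ℓ ℓ := dxMulti_mem _

lemma mem_polyForms_zero {w : RatForm ℓ} : w ∈ polyForms ℓ 0 ↔ ∃ r : Poly ℓ, r • 1 = w := by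
  rw [polyForms_eq_pow, pow_zero, Submodule.mem_one]
  simp [Algebra.algebraMap_eq_smul_one]

lemma dx_mul_mem {p : ℕ} (i : Fin ℓ) {w : RatForm ℓ} (hw : w ∈ polyForms ℓ p) :
    dx i * w ∈ polyForms ℓ (p + 1) := by
  rw [polyForms_eq_pow] at *
  rw [pow_succ']
  exact Submodule.mul_mem_mul (Submodule.subset_span ⟨i, rfl⟩) hw

lemma polyForms_induction {P : ℕ → RatForm ℓ → Prop} (h0 : ∀ r : Poly ℓ, P 0 (r • 1))
    (hz : ∀ p, P p 0)
    (hadd : ∀ p x y, P p x → P p y → P p (x + y))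
    (hmul : ∀ p i x, x ∈ polyForms ℓ p → P p x → P (p + 1) (dx i * x))
    {p : ℕ} {w : RatForm ℓ} (hw : w ∈ polyForms ℓ p) : P p w := by
  induction p generalizing w with
  | zero => obtain ⟨r, rfl⟩ := mem_polyForms_zero.mp hw; exact h0 r
  | succ p ih =>
    rw [polyForms_eq_pow, pow_succ'] at hw
    refine Submodule.mul_induction_on hw ?_ (fun x y => hadd _ x y)
    intro m hm x hx
    rw [← polyForms_eq_pow] at hx
    induction hm using Submodule.span_induction generalizing x with
    | mem m hm => obtain ⟨i, rfl⟩ := hm; exact hmul p i x hx (ih hx)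
    | zero => simpa using hz (p + 1)
    | add a b _ _ ha hb => rw [add_mul]; exact hadd _ _ _ (ha x hx) (hb x hx)
    | smul r a _ ha => rw [smul_mul_assoc, ← mul_smul_comm]; exact ha _ (Submodule.smul_mem _ _ hx)

lemma polyForms_eq_bot {p : ℕ} (hp : ℓ < p) : polyForms ℓ p = ⊥ := by
  rw [polyForms_eq_span, Submodule.span_eq_bot]
  rintro _ ⟨s, rfl⟩
  refine dxMulti_eq_zero fun hs => ?_
  have := Fintype.card_le_of_injective s hs
  simp at this
  omega

lemma mem_polyForms_top {w : RatForm ℓ} : w ∈ polyForms ℓ ℓ ↔ ∃ r : Poly ℓ, r • dxTop ℓ = w := by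
  rw [← Submodule.mem_span_singleton]
  have : polyForms ℓ ℓ = Submodule.span (Poly ℓ) {dxTop ℓ} := by
    apply le_antisymm
    · rw [polyForms_eq_span, Submodule.span_le]
      rintro _ ⟨s, rfl⟩
      have h := Submodule.mem_span_singleton_self (R := Poly ℓ) (dxTop ℓ)
      rcases dxMulti_top s with h1 | h1 | h1 <;> rw [h1]
      · exact zero_mem _
      · exact h
      · exact neg_mem h
    · rw [Submodule.span_singleton_le_iff_mem]; exact dxTop_mem ℓ
  rw [this]

lemma smul_dxTop_injective : Function.Injective (fun g : RatFun ℓ => g • dxTop ℓ) :=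
  smul_left_injective _ (dxTop_ne_zero ℓ)

lemma exists_eq_of_smul_dxTop_mem {g : RatFun ℓ} (h : g • dxTop ℓ ∈ polyForms ℓ ℓ) :
    ∃ r : Poly ℓ, algebraMap (Poly ℓ) (RatFun ℓ) r = g := by
  obtain ⟨r, hr⟩ := mem_polyForms_top.mp h
  refine ⟨r, smul_dxTop_injective ?_⟩
  simp only [algebraMap_smul, hr]

section Contract

variable (δ δ' : Derivation ℂ (Poly ℓ) (Poly ℓ))

lemma contract_ι_mul (m : Fin ℓ → RatFun ℓ) (x : RatForm ℓ) :
    contract δ (ExteriorAlgebra.ι _ m * x) =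
      (∑ i, algebraMap (Poly ℓ) (RatFun ℓ) (δ (X i)) * m i) • x -
        ExteriorAlgebra.ι _ m * contract δ x := by
  rw [contract]
  refine (CliffordAlgebra.contractLeft_ι_mul _ _ _).trans ?_
  congr 2
  simp [LinearMap.sum_apply, LinearMap.smul_apply]
  simp [Algebra.smul_def]

lemma contract_dx_mul (i : Fin ℓ) (x : RatForm ℓ) :
    contract δ (dx i * x) = δ (X i) • x - dx i * contract δ x := by
  rw [dx, contract_ι_mul]
  congr 1
  rw [Finset.sum_eq_single i (by intro j _ h; simp [h]) (by simp)]
  simp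

lemma contract_smul (r : Poly ℓ) (x : RatForm ℓ) : contract δ (r • x) = r • contract δ x :=
  ((contract δ).restrictScalars (Poly ℓ)).map_smul r x

lemma contract_one : contract δ (1 : RatForm ℓ) = 0 := by
  rw [contract]; exact CliffordAlgebra.contractLeft_one
    (Q := (0 : QuadraticForm (RatFun ℓ) (Fin ℓ → RatFun ℓ))) _

lemma contract_contract_self (x : RatForm ℓ) : contract δ (contract δ x) = 0 :=
  CliffordAlgebra.contractLeft_contractLeft _ _

lemma contract_comm (x : RatForm ℓ) : contract δ (contract δ' x) = -contract δ' (contract δ x) :=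
  CliffordAlgebra.contractLeft_comm _ _ _

lemma contract_eq_zero {w : RatForm ℓ} (hw : w ∈ polyForms ℓ 0) : contract δ w = 0 := by
  obtain ⟨r, rfl⟩ := mem_polyForms_zero.mp hw
  rw [contract_smul, contract_one, smul_zero]

lemma contract_mem {p : ℕ} {w : RatForm ℓ} (hw : w ∈ polyForms ℓ (p + 1)) :
    contract δ w ∈ polyForms ℓ p := by
  have : ∀ q, w ∈ polyForms ℓ q → ∀ p, q = p + 1 → contract δ w ∈ polyForms ℓ p := by
    intro q hq
    refine polyForms_induction (P := fun q w => ∀ p, q = p + 1 → contract δ w ∈ polyForms ℓ p)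
      ?_ ?_ ?_ ?_ hq
    · intro r p hp; omega
    · intro q p _; rw [map_zero]; exact zero_mem _
    · intro q x y hx hy p hp; rw [map_add]; exact add_mem (hx p hp) (hy p hp)
    · intro q i x hx ih p hp
      obtain rfl : q = p := by omega
      rw [contract_dx_mul]
      refine sub_mem (Submodule.smul_mem _ _ hx) ?_
      cases q with
      | zero => rw [contract_eq_zero δ hx, mul_zero]; exact zero_mem _
      | succ q => exact dx_mul_mem i (ih q rfl)
  exact this _ hw _ rfl

/-- The operator counts the factors $dx_i$ of a monomial form. -/
lemma sum_dx_mul_contract {p : ℕ} {w : RatForm ℓ} (hw : w ∈ polyForms ℓ p) :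
    ∑ i, dx i * contract (pderiv i) w = (p : Poly ℓ) • w := by
  refine polyForms_induction (P := fun p w => ∑ i, dx i * contract (pderiv i) w =
    (p : Poly ℓ) • w) ?_ ?_ ?_ ?_ hw
  · intro r; simp [contract_one]
  · intro p; simp
  · intro p x y hx hy; simp only [map_add, mul_add, Finset.sum_add_distrib, hx, hy, smul_add]
  · intro p j x hx ih
    have h : ∀ i, dx i * contract (pderiv i) (dx j * x) =
        (if i = j then dx j * x else 0) + dx j * (dx i * contract (pderiv i) x) := by
      intro i
      rw [contract_dx_mul, mul_sub, ← mul_assoc (dx i) (dx j),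
        show dx i * dx j = - (dx j * dx i) from
          eq_neg_of_add_eq_zero_left (ExteriorAlgebra.ι_add_mul_swap _ _), pderiv_X]
      by_cases h : i = j
      · subst h; simp [mul_assoc]
      · simp [h, mul_assoc, Ne.symm h]
    simp only [h, Finset.sum_add_distrib, ← Finset.mul_sum, ih]
    simp [add_smul, add_comm]

/-- A `p`-form is determined by its products with the `dx_i` if `p < ℓ`. -/
lemma eq_zero_of_dx_mul_eq_zero {p : ℕ} (hp : p < ℓ) {w : RatForm ℓ} (hw : w ∈ polyForms ℓ p)
    (h : ∀ i, dx i * w = 0) : w = 0 := by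
  have h1 := sum_dx_mul_contract hw
  -- Each of the $\ell$ summands of the counting operator equals $w$, so $\ell w=pw$.
  have h2 : ∀ i, dx i * contract (pderiv i) w = w := by
    intro i
    have := contract_dx_mul (pderiv i) i w
    rw [h i, map_zero, pderiv_X_self, one_smul, eq_comm, sub_eq_zero] at this
    exact this.symm
  simp only [h2, Finset.sum_const, Finset.card_univ, Fintype.card_fin] at h1
  have h3 : ((ℓ : Poly ℓ) - (p : Poly ℓ)) • w = 0 := by
    rw [sub_smul, ← h1, Nat.cast_smul_eq_nsmul, sub_self]
  refine smul_right_injective_ratForm (r := (ℓ : Poly ℓ) - (p : Poly ℓ)) ?_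
    (h3.trans (smul_zero _).symm)
  rw [sub_ne_zero]
  exact_mod_cast hp.ne'

lemma dx_mul_contract_top {w : RatForm ℓ} (hw : w ∈ polyForms ℓ ℓ) (i : Fin ℓ) :
    dx i * contract δ w = δ (X i) • w := by
  have h : dx i * w = 0 := by
    have := dx_mul_mem i hw
    rwa [polyForms_eq_bot (by omega)] at this
  have := contract_dx_mul δ i w
  rw [h, map_zero, eq_comm, sub_eq_zero] at this
  exact this.symm

/-- Every `(ℓ-1)`-form is the contraction of the volume form with a vector field. -/
lemma exists_contract_dxTop {p : ℕ} (hp : p + 1 = ℓ) {w : RatForm ℓ} (hw : w ∈ polyForms ℓ p) :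
    ∃ δ : Derivation ℂ (Poly ℓ) (Poly ℓ), contract δ (dxTop ℓ) = w := by
  have h : ∀ i, ∃ r : Poly ℓ, r • dxTop ℓ = dx i * w := fun i =>
    mem_polyForms_top.mp (hp ▸ dx_mul_mem i hw)
  choose r hr using h
  -- The components of $\delta$ are forced by $dx_i\wedge\iota_\delta(dx_1\wedge\cdots\wedge
  -- dx_\ell)=\delta(x_i)\,dx_1\wedge\cdots\wedge dx_\ell$.
  refine ⟨mkDerivation ℂ r, ?_⟩
  rw [← sub_eq_zero]
  refine eq_zero_of_dx_mul_eq_zero (p := p) (by omega) (sub_mem (contract_mem _ ?_) hw) ?_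
  · rw [hp]; exact dxTop_mem ℓ
  · intro i
    rw [mul_sub, dx_mul_contract_top _ (dxTop_mem ℓ), mkDerivation_X, hr, sub_self]

end Contract

end LogForms

namespace LogForms

open MvPolynomial

variable {ℓ : ℕ}

/-! ### Degrees of forms. -/

section Homogeneous

lemma IsHomog.add {a b : Poly ℓ} {k : ℤ} (ha : IsHomog a k) (hb : IsHomog b k) :
    IsHomog (a + b) k := by
  intro d hd
  by_cases h : a.coeff d = 0
  · exact hb d (by simpa [h] using hd)
  · exact ha d h

lemma IsHomog.neg {a : Poly ℓ} {k : ℤ} (ha : IsHomog a k) : IsHomog (-a) k :=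
  fun d hd => ha d (by simpa using hd)

lemma IsHomog.smul {a : Poly ℓ} {k : ℤ} (c : ℂ) (ha : IsHomog a k) : IsHomog (c • a) k :=
  fun d hd => ha d (by intro h; simp [h] at hd)

lemma isHomog_zero (k : ℤ) : IsHomog (0 : Poly ℓ) k := fun d hd => by simp at hd

lemma isHomog_mul_X {g : Poly ℓ} {k : ℤ} (i : Fin ℓ) :
    IsHomog (g * X i) (k + 1) ↔ IsHomog g k := by
  constructor
  · intro h d hd
    have := h (d + Finsupp.single i 1) (by rwa [coeff_mul_X])
    simp only [map_add, Finsupp.degree_single, Nat.cast_add, Nat.cast_one] at this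
    omega
  · intro h d hd
    rw [coeff_mul_X'] at hd
    split_ifs at hd with hi
    · have h1 := h _ hd
      have h2 : Finsupp.single i 1 ≤ d := by
        rw [Finsupp.single_le_iff]
        exact Nat.one_le_iff_ne_zero.mpr (Finsupp.mem_support_iff.mp hi)
      have h3 := congrArg Finsupp.degree (tsub_add_cancel_of_le h2)
      simp only [map_add, Finsupp.degree_single] at h3
      omega
    · exact absurd rfl hd

lemma smul_dxMulti_mem_deg {p : ℕ} {k : ℤ} {g : Poly ℓ} (hg : IsHomog g (k - p))
    (s : Fin p → Fin ℓ) : g • dxMulti s ∈ polyFormsDeg ℓ p k :=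
  Submodule.subset_span ⟨g, s, hg, rfl⟩

lemma dx_mul_mem_deg {p : ℕ} {k : ℤ} (i : Fin ℓ) {w : RatForm ℓ} (hw : w ∈ polyFormsDeg ℓ p k) :
    dx i * w ∈ polyFormsDeg ℓ (p + 1) (k + 1) := by
  induction hw using Submodule.span_induction with
  | mem w hw =>
    obtain ⟨g, s, hg, rfl⟩ := hw
    rw [mul_smul_comm]
    change g • (dx i * dxMulti s) ∈ _
    rw [← dxMulti_cons]
    refine smul_dxMulti_mem_deg ?_ _
    convert hg using 1
    push_cast; ring
  | zero => rw [mul_zero]; exact zero_mem _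
  | add a b _ _ ha hb => rw [mul_add]; exact add_mem ha hb
  | smul c a _ ha => rw [mul_smul_comm]; exact Submodule.smul_mem _ _ ha

/-- The degree is preserved because $\iota_\chi$ trades $dx_i$ for $x_i$, both of degree $1$. -/
lemma contract_euler_smul_dxMulti_mem_deg {p : ℕ} (s : Fin (p + 1) → Fin ℓ) {k : ℤ} {g : Poly ℓ}
    (hg : IsHomog g (k - (p + 1 : ℕ))) :
    contract (euler ℓ) (g • dxMulti s) ∈ polyFormsDeg ℓ p k := by
  induction p generalizing k with
  | zero =>
    rw [← Fin.cons_self_tail s, dxMulti_cons, contract_smul, contract_dx_mul,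
      contract_eq_zero _ (dxMulti_mem _), mul_zero, sub_zero, euler, mkDerivation_X, smul_smul]
    refine smul_dxMulti_mem_deg ?_ _
    have := (isHomog_mul_X (s 0)).mpr hg
    convert this using 1
    push_cast; ring
  | succ p ih =>
    have hg' : IsHomog g ((k - 1) - (p + 1 : ℕ)) := by
      convert hg using 1
      push_cast; ring
    rw [← Fin.cons_self_tail s, dxMulti_cons, contract_smul, contract_dx_mul, smul_sub,
      euler, mkDerivation_X, smul_smul, ← mul_smul_comm, ← contract_smul]
    refine sub_mem (smul_dxMulti_mem_deg ?_ _) ?_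
    · have := (isHomog_mul_X (s 0)).mpr hg
      convert this using 1
      push_cast; ring
    · have := dx_mul_mem_deg (s 0) (ih (Fin.tail s) hg')
      rwa [sub_add_cancel] at this

lemma exists_of_mem_polyFormsDeg_top {k : ℤ} {w : RatForm ℓ} (hw : w ∈ polyFormsDeg ℓ ℓ k) :
    ∃ h : Poly ℓ, IsHomog h (k - ℓ) ∧ h • dxTop ℓ = w := by
  induction hw using Submodule.span_induction with
  | mem w hw =>
    obtain ⟨g, s, hg, rfl⟩ := hw
    change ∃ h : Poly ℓ, IsHomog h (k - ℓ) ∧ h • dxTop ℓ = g • dxMulti s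
    rcases dxMulti_top s with h | h | h <;> rw [h]
    · exact ⟨0, isHomog_zero _, by simp⟩
    · exact ⟨g, hg, rfl⟩
    · exact ⟨-g, hg.neg, by simp⟩
  | zero => exact ⟨0, isHomog_zero _, by simp⟩
  | add a b _ _ ha hb =>
    obtain ⟨x, hx, rfl⟩ := ha
    obtain ⟨y, hy, rfl⟩ := hb
    exact ⟨x + y, hx.add hy, add_smul _ _ _⟩
  | smul c a _ ha =>
    obtain ⟨x, hx, rfl⟩ := ha
    exact ⟨c • x, hx.smul c, smul_assoc _ _ _⟩

/-- The degree of $g$ is recovered by multiplying with one $dx_i$, which gives $gx_i$ times the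
volume form. -/
lemma smul_contract_euler_dxTop_mem_deg_iff {p : ℕ} (hp : p + 1 = ℓ) {g : Poly ℓ} {k : ℤ} :
    g • contract (euler ℓ) (dxTop ℓ) ∈ polyFormsDeg ℓ p k ↔ IsHomog g (k - ℓ) := by
  constructor
  · intro h
    have i : Fin ℓ := ⟨0, by omega⟩
    have h1 := dx_mul_mem_deg i h
    rw [mul_smul_comm, dx_mul_contract_top _ (dxTop_mem ℓ), euler, mkDerivation_X, smul_smul,
      hp] at h1
    obtain ⟨a, ha, ha'⟩ := exists_of_mem_polyFormsDeg_top h1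
    have h2 : a = g * X i := by
      have : algebraMap (Poly ℓ) (RatFun ℓ) a = algebraMap (Poly ℓ) (RatFun ℓ) (g * X i) :=
        smul_dxTop_injective (by simpa only [algebraMap_smul] using ha')
      exact IsFractionRing.injective (Poly ℓ) (RatFun ℓ) this
    rw [h2, show k + 1 - (ℓ : ℤ) = (k - ℓ) + 1 by ring, isHomog_mul_X] at ha
    exact ha
  · intro h
    subst hp
    rw [← contract_smul]
    exact contract_euler_smul_dxMulti_mem_deg _ h

end Homogeneous

lemma contract_ι_mul_of_eq {δ : Derivation ℂ (Poly ℓ) (Poly ℓ)} {m : Fin ℓ → RatFun ℓ}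
    {q : RatFun ℓ} (h : contract δ (ExteriorAlgebra.ι _ m) = algebraMap (RatFun ℓ) (RatForm ℓ) q)
    (x : RatForm ℓ) : contract δ (ExteriorAlgebra.ι _ m * x) =
      q • x - ExteriorAlgebra.ι _ m * contract δ x := by
  have h1 := contract_ι_mul δ m 1
  rw [mul_one, contract_one, mul_zero, sub_zero, h, ← Algebra.algebraMap_eq_smul_one] at h1
  rw [contract_ι_mul, ← (algebraMap (RatFun ℓ) (RatForm ℓ)).injective h1]

/-! ### Logarithmic forms and the cohomology in top degree. -/

namespace Arrangement

variable {n : ℕ} (A : Arrangement ℓ n)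

lemma algebraMap_form_ne_zero (H : Fin n) : algebraMap (Poly ℓ) (RatFun ℓ) (A.form H) ≠ 0 := by
  simpa using A.form_ne_zero H

lemma defEq_ne_zero : A.defEq ≠ 0 := Finset.prod_ne_zero_iff.mpr fun H _ => A.form_ne_zero H

lemma algebraMap_defEq_ne_zero : algebraMap (Poly ℓ) (RatFun ℓ) A.defEq ≠ 0 := by
  simpa using A.defEq_ne_zero

lemma contract_dlog_mul (δ : Derivation ℂ (Poly ℓ) (Poly ℓ)) (H : Fin n) (x : RatForm ℓ) :
    contract δ (A.dlog H * x) = (algebraMap (Poly ℓ) (RatFun ℓ) (δ (A.form H)) /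
        algebraMap (Poly ℓ) (RatFun ℓ) (A.form H)) • x - A.dlog H * contract δ x :=
  contract_ι_mul_of_eq (A.contract_dlog δ H) x

lemma contract_omega_mul {δ : Derivation ℂ (Poly ℓ) (Poly ℓ)} {lam : Fin n → ℂ} {r : Poly ℓ}
    (h : contract δ (A.omega lam) = algebraMap (Poly ℓ) (RatForm ℓ) r) (x : RatForm ℓ) :
    contract δ (A.omega lam * x) = r • x - A.omega lam * contract δ x := by
  rw [IsScalarTower.algebraMap_apply (Poly ℓ) (RatFun ℓ) (RatForm ℓ)] at h
  rw [omega_eq] at h ⊢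
  rw [contract_ι_mul_of_eq h, algebraMap_smul]

lemma contract_euler_dlog_mul (H : Fin n) (x : RatForm ℓ) :
    contract (euler ℓ) (A.dlog H * x) = x - A.dlog H * contract (euler ℓ) x := by
  rw [contract_dlog_mul, euler_form, div_self (A.algebraMap_form_ne_zero H), one_smul]

lemma euler_mem_logDer : euler ℓ ∈ A.logDer := fun H => by rw [euler_form]

/-- In $\frac{d\alpha_H}{\alpha_H}\wedge\iota_\delta
w=\frac{\delta(\alpha_H)}{\alpha_H}w-\iota_\delta(\frac{d\alpha_H}{\alpha_H}\wedge w)$ the first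
coefficient is a polynomial. -/
lemma contract_mem_logForms {δ : Derivation ℂ (Poly ℓ) (Poly ℓ)} (hδ : δ ∈ A.logDer) {p : ℕ}
    {w : RatForm ℓ} (hw : w ∈ A.logForms (p + 1)) : contract δ w ∈ A.logForms p := by
  have h1 : A.defEq • contract δ w ∈ polyForms ℓ p := by
    rw [← contract_smul]; exact contract_mem δ hw.1
  refine ⟨h1, fun H => ?_⟩
  obtain ⟨c, hc⟩ := hδ H
  have h2 := A.contract_dlog_mul δ H w
  rw [hc, map_mul (algebraMap _ _), mul_div_cancel_left₀ _ (A.algebraMap_form_ne_zero H), algebraMap_smul,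
    eq_sub_iff_add_eq, ← eq_sub_iff_add_eq'] at h2
  rw [h2, smul_sub, smul_comm, ← contract_smul]
  exact sub_mem (Submodule.smul_mem _ _ hw.1) (contract_mem δ (hw.2 H))

lemma contract_eq_zero_of_mem_logForms (δ : Derivation ℂ (Poly ℓ) (Poly ℓ)) {w : RatForm ℓ}
    (hw : w ∈ A.logForms 0) : contract δ w = 0 := by
  apply smul_right_injective_ratForm A.defEq_ne_zero
  simp only [← contract_smul, contract_eq_zero δ hw.1, smul_zero]

lemma mem_relForms {p : ℕ} {w : RatForm ℓ} :
    w ∈ A.relForms p ↔ w ∈ A.logForms p ∧ contract (euler ℓ) w = 0 := Iff.rfl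

lemma contract_mem_relForms {δ : Derivation ℂ (Poly ℓ) (Poly ℓ)} (hδ : δ ∈ A.logDer) {p : ℕ}
    {w : RatForm ℓ} (hw : w ∈ A.relForms (p + 1)) : contract δ w ∈ A.relForms p := by
  refine ⟨A.contract_mem_logForms hδ hw.1, ?_⟩
  change contract (euler ℓ) (contract δ w) = 0
  rw [contract_comm, (A.mem_relForms.mp hw).2, map_zero, neg_zero]

lemma contract_euler_dlog_mul_mem_relForms (H : Fin n) {p : ℕ} {w : RatForm ℓ}
    (hw : w ∈ A.logForms p) : contract (euler ℓ) (A.dlog H * w) ∈ A.relForms p :=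
  ⟨A.contract_mem_logForms A.euler_mem_logDer (A.dlog_mul_mem_logForms H hw),
    contract_contract_self _ _⟩

/-- Because $\iota_\chi(d\alpha_H/\alpha_H)=1$, the map
$w\mapsto\iota_\chi(\frac{d\alpha_H}{\alpha_H}\wedge w)$ is a projection of $\Omega^p(\mathcal A)$
onto $\Omega^p_0(\mathcal A)$. -/
lemma contract_euler_dlog_mul_of_mem_relForms (H : Fin n) {p : ℕ} {w : RatForm ℓ}
    (hw : w ∈ A.relForms p) : contract (euler ℓ) (A.dlog H * w) = w := by
  rw [contract_euler_dlog_mul, (A.mem_relForms.mp hw).2, mul_zero, sub_zero]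

lemma logForms_eq_bot {p : ℕ} (hp : ℓ < p) : A.logForms p = ⊥ := by
  rw [eq_bot_iff]
  intro w hw
  have h := hw.1
  rw [polyForms_eq_bot hp] at h
  exact smul_right_injective_ratForm A.defEq_ne_zero (h.trans (smul_zero _).symm)

/-- The projection onto $\Omega^p_0$ factors through $\Omega^{p+1}(\mathcal A)=0$. -/
lemma relForms_eq_bot (H : Fin n) {p : ℕ} (hp : ℓ ≤ p) : A.relForms p = ⊥ := by
  rw [eq_bot_iff]
  intro w hw
  rw [← A.contract_euler_dlog_mul_of_mem_relForms H hw]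
  have := A.dlog_mul_mem_logForms H hw.1
  rw [A.logForms_eq_bot (by omega)] at this
  rw [(Submodule.mem_bot _).mp this, map_zero]
  exact zero_mem _

/-- For $w=g/f$, the form $g\,d\alpha_H/\alpha_H$ is polynomial; contracting it with a $\partial_i$
for which $\partial_i\alpha_H\ne0$ gives $\alpha_H\mid g$. By coprimality $f\mid g$. -/
lemma exists_smul_one_of_mem_logForms_zero {w : RatForm ℓ} (hw : w ∈ A.logForms 0) :
    ∃ r : Poly ℓ, r • 1 = w := by
  obtain ⟨g, hg⟩ := mem_polyForms_zero.mp hw.1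
  have hdvd : ∀ H, A.form H ∣ g := by
    intro H
    obtain ⟨i, hi⟩ : ∃ i, A.coeff H i ≠ 0 := by
      by_contra! h; exact A.coeff_ne_zero H (funext h)
    have h1 := contract_mem (pderiv i) (hw.2 H)
    rw [← mul_smul_comm, ← hg, contract_dlog_mul, contract_smul, contract_one, smul_zero, mul_zero,
      sub_zero] at h1
    obtain ⟨r, hr⟩ := mem_polyForms_zero.mp h1
    have h2 : pderiv i (A.form H) = C (A.coeff H i) := by
      simp [form, pderiv_X, Pi.single_apply]
    rw [h2, ← algebraMap_smul (RatFun ℓ) r, ← algebraMap_smul (RatFun ℓ) g, smul_smul] at hr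
    have h3 := smul_left_injective (RatFun ℓ) (one_ne_zero (α := RatForm ℓ)) hr
    rw [div_mul_eq_mul_div, eq_div_iff (A.algebraMap_form_ne_zero H), ← map_mul, ← map_mul] at h3
    have h4 := IsFractionRing.injective (Poly ℓ) (RatFun ℓ) h3
    refine ⟨C ((A.coeff H i)⁻¹) * r, ?_⟩
    calc g = C ((A.coeff H i)⁻¹) * (C (A.coeff H i) * g) := by
          rw [← mul_assoc, ← map_mul, inv_mul_cancel₀ hi, map_one, one_mul]
      _ = _ := by rw [← h4]; ring
  obtain ⟨r, hr⟩ : A.defEq ∣ g :=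
    Finset.prod_dvd_of_isRelPrime (fun H _ H' _ hne => A.isRelPrime_form hne) fun H _ => hdvd H
  refine ⟨r, smul_right_injective_ratForm A.defEq_ne_zero ?_⟩
  simp only
  rw [← hg, hr, mul_smul]

lemma smul_one_mem_relForms (r : Poly ℓ) : r • (1 : RatForm ℓ) ∈ A.relForms 0 := by
  refine ⟨⟨?_, fun H => ?_⟩, ?_⟩
  · exact Submodule.smul_mem _ _ (mem_polyForms_zero.mpr ⟨r, rfl⟩)
  · have h1 : A.form H • A.dlog H ∈ polyForms ℓ 1 := by
      rw [form_smul_dlog, ← mul_one (ExteriorAlgebra.ι _ _)]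
      exact A.dvec_mul_mem_polyForms H (mem_polyForms_zero.mpr ⟨1, one_smul _ _⟩)
    obtain ⟨c, hc⟩ : A.form H ∣ A.defEq := Finset.dvd_prod_of_mem _ (Finset.mem_univ H)
    rw [mul_smul_comm, mul_one, hc, mul_comm, mul_smul, smul_comm (A.form H)]
    exact Submodule.smul_mem _ _ (Submodule.smul_mem _ _ h1)
  · change contract (euler ℓ) (r • 1) = 0
    rw [contract_smul, contract_one, smul_zero]

/-- The generator `ι_χ(dx_1 ∧ ⋯ ∧ dx_ℓ) / f` of `Ω^{ℓ-1}_0(A)`. -/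
def topForm : RatForm ℓ := (algebraMap (Poly ℓ) (RatFun ℓ) A.defEq)⁻¹ • contract (euler ℓ) (dxTop ℓ)

lemma defEq_smul_topForm : A.defEq • A.topForm = contract (euler ℓ) (dxTop ℓ) := by
  rw [topForm, ← algebraMap_smul (RatFun ℓ) A.defEq, smul_smul,
    mul_inv_cancel₀ A.algebraMap_defEq_ne_zero, one_smul]

lemma dlog_mul_contract_dxTop (δ : Derivation ℂ (Poly ℓ) (Poly ℓ)) (H : Fin n) :
    A.dlog H * contract δ (dxTop ℓ) = (algebraMap (Poly ℓ) (RatFun ℓ) (δ (A.form H)) /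
        algebraMap (Poly ℓ) (RatFun ℓ) (A.form H)) • dxTop ℓ := by
  have h := A.contract_dlog_mul δ H (dxTop ℓ)
  have h0 : A.dlog H * dxTop ℓ = 0 := by
    apply smul_right_injective_ratForm (A.form_ne_zero H)
    simp only [smul_zero]
    rw [← smul_mul_assoc, form_smul_dlog]
    have := A.dvec_mul_mem_polyForms H (dxTop_mem ℓ)
    rwa [polyForms_eq_bot (by omega)] at this
  rw [h0, map_zero, eq_comm, sub_eq_zero] at h
  exact h.symm

lemma topForm_mem {p : ℕ} (hp : p + 1 = ℓ) : A.topForm ∈ A.relForms p := by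
  refine ⟨⟨?_, fun H => ?_⟩, ?_⟩
  · rw [defEq_smul_topForm]
    exact contract_mem _ (by rw [hp]; exact dxTop_mem ℓ)
  · rw [← mul_smul_comm, defEq_smul_topForm, dlog_mul_contract_dxTop, euler_form,
      div_self (A.algebraMap_form_ne_zero H), one_smul, hp]
    exact dxTop_mem ℓ
  · change contract (euler ℓ) A.topForm = 0
    rw [topForm, map_smul, contract_contract_self, smul_zero]

/-- Here $\frac{d\alpha_H}{\alpha_H}\wedge w$ is $g/f$ times the volume form, and $\iota_\chi$
recovers $w$ from it. -/
lemma exists_smul_topForm (H : Fin n) {p : ℕ} (hp : p + 1 = ℓ) {w : RatForm ℓ}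
    (hw : w ∈ A.relForms p) : ∃ g : Poly ℓ, g • A.topForm = w := by
  obtain ⟨g, hg⟩ := mem_polyForms_top.mp (by
    have := (A.dlog_mul_mem_logForms H hw.1).1
    rwa [hp] at this)
  refine ⟨g, smul_right_injective_ratForm A.defEq_ne_zero ?_⟩
  simp only
  rw [smul_comm, defEq_smul_topForm, ← contract_smul, hg, contract_smul,
    A.contract_euler_dlog_mul_of_mem_relForms H hw]

lemma smul_topForm_eq_zero {g : Poly ℓ} (hp : 1 ≤ ℓ) (h : g • A.topForm = 0) : g = 0 := by
  have h1 : g • contract (euler ℓ) (dxTop ℓ) = 0 := by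
    rw [← defEq_smul_topForm, smul_comm, h, smul_zero]
  have i : Fin ℓ := ⟨0, hp⟩
  have h2 := congrArg (dx i * ·) h1
  simp only [mul_smul_comm, dx_mul_contract_top _ (dxTop_mem ℓ), euler, mkDerivation_X, smul_smul,
    mul_zero] at h2
  by_contra hg
  exact dxTop_ne_zero ℓ (smul_right_injective_ratForm (mul_ne_zero hg (X_ne_zero i))
    (h2.trans (smul_zero _).symm))

/-- `I_{0,λ}(A)` annihilates the cohomology. -/
lemma smul_mem_coboundaries_of_contract {lam : Fin n → ℂ}
    {δ : Derivation ℂ (Poly ℓ) (Poly ℓ)} (hδ : δ ∈ A.logDer) {r : Poly ℓ}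
    (hr : contract δ (A.omega lam) = algebraMap (Poly ℓ) (RatForm ℓ) r) {p : ℕ} {z : RatForm ℓ}
    (hz : z ∈ A.relForms p) (hωz : A.omega lam * z = 0) : r • z ∈ A.coboundaries lam p := by
  -- Contraction with $\delta$ is a homotopy between multiplication by $r$ and zero.
  have h := A.contract_omega_mul hr z
  rw [hωz, map_zero, eq_comm, sub_eq_zero] at h
  rw [h]
  cases p with
  | zero =>
    rw [A.contract_eq_zero_of_mem_logForms δ hz.1, mul_zero]
    exact zero_mem _
  | succ p => exact ⟨_, A.contract_mem_relForms hδ hz, rfl⟩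

lemma smul_mem_coboundaries {lam : Fin n → ℂ} {r : Poly ℓ} (hr : r ∈ A.ideal lam) {p : ℕ}
    {z : RatForm ℓ} (hz : z ∈ A.relForms p) (hωz : A.omega lam * z = 0) :
    r • z ∈ A.coboundaries lam p := by
  induction hr using Submodule.span_induction with
  | mem r hr =>
    obtain ⟨δ, hδ, hr⟩ := hr
    exact A.smul_mem_coboundaries_of_contract hδ hr hz hωz
  | zero => rw [zero_smul]; exact zero_mem _
  | add a b _ _ ha hb => rw [add_smul]; exact add_mem ha hb
  | smul a r _ h => rw [smul_assoc]; exact Submodule.smul_mem _ _ h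

lemma contract_omega_of_eq_mul {δ : Derivation ℂ (Poly ℓ) (Poly ℓ)} {c : Fin n → Poly ℓ}
    (hc : ∀ H, δ (A.form H) = A.form H * c H) (lam : Fin n → ℂ) :
    contract δ (A.omega lam) = algebraMap (Poly ℓ) (RatForm ℓ) (∑ H, lam H • c H) := by
  rw [contract_omega, IsScalarTower.algebraMap_apply (Poly ℓ) (RatFun ℓ) (RatForm ℓ),
    map_sum (algebraMap (Poly ℓ) (RatFun ℓ))]
  congr 1
  refine Finset.sum_congr rfl fun H _ => ?_
  rw [hc, map_mul (algebraMap _ _), mul_div_cancel_left₀ _ (A.algebraMap_form_ne_zero H),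
    Algebra.smul_def, Algebra.smul_def, map_mul (algebraMap _ _),
    ← IsScalarTower.algebraMap_apply]

lemma exists_contract_omega {δ : Derivation ℂ (Poly ℓ) (Poly ℓ)} (hδ : δ ∈ A.logDer)
    (lam : Fin n → ℂ) : ∃ r : Poly ℓ,
      contract δ (A.omega lam) = algebraMap (Poly ℓ) (RatForm ℓ) r := by
  choose c hc using hδ
  exact ⟨_, A.contract_omega_of_eq_mul hc lam⟩

/-- The top forms dual to a logarithmic vector field. -/
lemma exists_logDer_of_mem_logForms {p : ℕ} (hp : p + 1 = ℓ) {w : RatForm ℓ}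
    (hw : w ∈ A.logForms p) : ∃ δ ∈ A.logDer, contract δ (dxTop ℓ) = A.defEq • w := by
  obtain ⟨δ, hδ⟩ := exists_contract_dxTop hp hw.1
  refine ⟨δ, fun H => ?_, hδ⟩
  have h := hw.2 H
  rw [← mul_smul_comm, ← hδ, dlog_mul_contract_dxTop, hp] at h
  obtain ⟨r, hr⟩ := exists_eq_of_smul_dxTop_mem h
  rw [eq_div_iff (A.algebraMap_form_ne_zero H), ← map_mul] at hr
  exact ⟨r, by rw [mul_comm]; exact (IsFractionRing.injective (Poly ℓ) (RatFun ℓ) hr).symm⟩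

/-- With $\tau$ for `topForm`, $\omega_\lambda\wedge\tau=0$ gives
$\omega_\lambda\wedge\iota_\delta\tau=\langle\delta,\omega_\lambda\rangle\tau$. Every
$u\in\Omega^{\ell-2}_0$ is $-\iota_\delta\tau$, where $\delta$ is the logarithmic field dual to
$\frac{d\alpha_H}{\alpha_H}\wedge u$. -/
lemma smul_topForm_mem_coboundaries_iff (H : Fin n) {lam : Fin n → ℂ} (hlam : ∑ H, lam H = 0)
    {p : ℕ} (hp : p + 1 = ℓ) {r : Poly ℓ} :
    r • A.topForm ∈ A.coboundaries lam p ↔ r ∈ A.ideal lam := by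
  have hω : A.omega lam * A.topForm = 0 := by
    have := A.omega_mul_mem_relForms hlam (A.topForm_mem hp)
    rw [A.relForms_eq_bot H (by omega)] at this
    exact this
  constructor
  · intro h
    cases p with
    -- For $\ell=1$ there are no forms in lower degree, so $r$ itself is zero.
    | zero =>
      rw [A.smul_topForm_eq_zero (by omega) h]
      exact zero_mem _
    | succ p =>
      obtain ⟨u, hu, hur⟩ := h
      change A.omega lam * u = _ at hur
      obtain ⟨δ, hδ, hδu⟩ := A.exists_logDer_of_mem_logForms hp (A.dlog_mul_mem_logForms H hu.1)
      obtain ⟨s, hs⟩ := A.exists_contract_omega hδ lam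
      have h1 : u = -contract δ A.topForm := by
        apply smul_right_injective_ratForm A.defEq_ne_zero
        simp only
        rw [smul_neg, ← contract_smul, defEq_smul_topForm, contract_comm, hδu, neg_neg,
          contract_smul, A.contract_euler_dlog_mul_of_mem_relForms H hu]
      have h2 := A.contract_omega_mul hs A.topForm
      rw [hω, map_zero, eq_comm, sub_eq_zero] at h2
      rw [h1, mul_neg, ← h2, neg_eq_iff_add_eq_zero, ← add_smul] at hur
      have h3 := A.smul_topForm_eq_zero (by omega) hur
      rw [eq_neg_of_add_eq_zero_right h3]
      exact neg_mem (Ideal.subset_span ⟨δ, hδ, hs⟩)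
  · intro h
    exact A.smul_mem_coboundaries h (A.topForm_mem hp) hω

/-- The source of the shift: $f$ times `topForm` has degree $\ell$ and $f$ has degree $n$. -/
lemma isHomogForm_smul_topForm {p : ℕ} (hp : p + 1 = ℓ) {g : Poly ℓ} {j : ℤ} :
    A.IsHomogForm p (g • A.topForm) j ↔ IsHomog g (j + ((n : ℤ) - (ℓ : ℤ))) := by
  rw [IsHomogForm, smul_comm, defEq_smul_topForm, smul_contract_euler_dxTop_mem_deg_iff hp,
    add_sub_assoc]

/-- The cohomology in the top degree `ℓ - 1`. -/
theorem exists_cohomology_top_equiv (H : Fin n) {lam : Fin n → ℂ} (hlam : ∑ H, lam H = 0)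
    {p : ℕ} (hp : p + 1 = ℓ) :
    ∃ e : A.Cohomology lam p ≃ₗ[Poly ℓ] (Poly ℓ ⧸ A.ideal lam),
      ∀ j : ℤ, e '' A.cohomologyDeg lam p j =
        quotDeg (A.ideal lam) (j + ((n : ℤ) - (ℓ : ℤ))) := by
  have hcoc : ∀ w ∈ A.relForms p, w ∈ A.cocycles lam p := by
    intro w hw
    refine ⟨hw, ?_⟩
    have := A.omega_mul_mem_relForms hlam hw
    rw [A.relForms_eq_bot H (by omega)] at this
    exact this
  let τ : A.cocycles lam p := ⟨A.topForm, hcoc _ (A.topForm_mem hp)⟩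
  let φ : Poly ℓ →ₗ[Poly ℓ] A.Cohomology lam p :=
    LinearMap.toSpanSingleton (Poly ℓ) _ (Submodule.Quotient.mk τ)
  have hφ : ∀ g, φ g = Submodule.Quotient.mk (g • τ) := fun g => rfl
  have hsurj : Function.Surjective φ := by
    intro c
    obtain ⟨⟨z, hz⟩, rfl⟩ := Submodule.Quotient.mk_surjective _ c
    obtain ⟨g, hg⟩ := A.exists_smul_topForm H hp hz.1
    exact ⟨g, by rw [hφ]; congr 1; exact Subtype.ext hg⟩
  have hker : LinearMap.ker φ = A.ideal lam := by
    ext g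
    rw [LinearMap.mem_ker, hφ, Submodule.Quotient.mk_eq_zero]
    exact A.smul_topForm_mem_coboundaries_iff H hlam hp
  let e := ((Submodule.quotEquivOfEq _ _ hker.symm).trans
    (φ.quotKerEquivOfSurjective hsurj)).symm
  have he : ∀ g, e (φ g) = Ideal.Quotient.mk (A.ideal lam) g := by
    intro g
    rw [LinearEquiv.symm_apply_eq]
    rfl
  refine ⟨e, fun j => ?_⟩
  ext x
  constructor
  · rintro ⟨_, ⟨⟨z, hz⟩, hzj, rfl⟩, rfl⟩
    obtain ⟨g, rfl⟩ := A.exists_smul_topForm H hp hz.1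
    exact ⟨g, (A.isHomogForm_smul_topForm hp).mp hzj, (he g).symm⟩
  · rintro ⟨g, hg, rfl⟩
    exact ⟨φ g, ⟨g • τ, (A.isHomogForm_smul_topForm hp).mpr hg, rfl⟩, he g⟩

lemma subsingleton_cohomology_iff {lam : Fin n → ℂ} {p : ℕ} :
    Subsingleton (A.Cohomology lam p) ↔
      ∀ z ∈ A.relForms p, A.omega lam * z = 0 → z ∈ A.coboundaries lam p := by
  rw [Submodule.Quotient.subsingleton_iff, Submodule.submoduleOf, Submodule.comap_subtype_eq_top]
  exact ⟨fun h z hz hz' => h ⟨hz, hz'⟩, fun h z hz => h z hz.1 hz.2⟩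

end Arrangement

end LogForms

/-! ### The zero locus of $I_{0,\lambda}$. -/

namespace LogForms

open MvPolynomial

variable {ℓ : ℕ}

section Taylor

/-- The maximal ideal of a point. -/
abbrev pointIdeal (v : Fin ℓ → ℂ) : Ideal (Poly ℓ) := RingHom.ker (MvPolynomial.eval v)

lemma X_sub_C_mem_pointIdeal (v : Fin ℓ → ℂ) (i : Fin ℓ) : X i - C (v i) ∈ pointIdeal v := by
  simp [RingHom.mem_ker]

lemma sub_C_eval_mem_pointIdeal (v : Fin ℓ → ℂ) (q : Poly ℓ) :
    q - C (MvPolynomial.eval v q) ∈ pointIdeal v := by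
  simp [RingHom.mem_ker]

lemma sub_taylor_mem_sq (v : Fin ℓ → ℂ) (q : Poly ℓ) :
    q - (C (MvPolynomial.eval v q) + ∑ j, C (MvPolynomial.eval v (pderiv j q)) * (X j - C (v j))) ∈
      pointIdeal v • pointIdeal v := by
  induction q using MvPolynomial.induction_on with
  | C a => simp
  | add p q hp hq =>
    have := add_mem hp hq
    convert this using 1
    simp only [map_add, add_mul, Finset.sum_add_distrib]
    ring
  | mul_X q i hq =>
    have h1 := Submodule.smul_mem _ (C (v i)) hq
    have h2 : (X i - C (v i)) • (q - C (MvPolynomial.eval v q)) ∈ pointIdeal v • pointIdeal v :=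
      Submodule.smul_mem_smul (X_sub_C_mem_pointIdeal v i) (sub_C_eval_mem_pointIdeal v q)
    have := add_mem h1 h2
    convert this using 1
    have h3 : ∀ j, C (MvPolynomial.eval v (pderiv j (q * X i))) * (X j - C (v j)) =
        C (v i) * (C (MvPolynomial.eval v (pderiv j q)) * (X j - C (v j))) +
          (if j = i then C (MvPolynomial.eval v q) * (X i - C (v i)) else 0 : Poly ℓ) := by
      intro j
      rw [Derivation.leibniz, pderiv_X]
      by_cases h : j = i
      · subst h; simp; ring
      · simp [h, Ne.symm h]; ring
    simp only [h3, Finset.sum_add_distrib, ← Finset.mul_sum, smul_eq_mul]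
    simp
    ring

lemma mem_sq_of_pderiv {v : Fin ℓ → ℂ} {q : Poly ℓ} (h0 : MvPolynomial.eval v q = 0)
    (h : ∀ j, MvPolynomial.eval v (pderiv j q) = 0) : q ∈ pointIdeal v • pointIdeal v := by
  simpa [h0, h] using sub_taylor_mem_sq v q

end Taylor

namespace Arrangement

variable {n : ℕ} (A : Arrangement ℓ n)

lemma eval_form (H : Fin n) (v : Fin ℓ → ℂ) : MvPolynomial.eval v (A.form H) = A.eval H v := by
  simp [form, Arrangement.eval]

lemma eval_defEq_ne_zero {v : Fin ℓ → ℂ} :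
    MvPolynomial.eval v A.defEq ≠ 0 ↔ ∀ H, A.eval H v ≠ 0 := by
  simp [defEq, map_prod, eval_form, Finset.prod_eq_zero_iff]

lemma mkDerivation_form (q : Fin ℓ → Poly ℓ) (H : Fin n) :
    mkDerivation ℂ q (A.form H) = ∑ i, C (A.coeff H i) * q i := by
  simp [form, mkDerivation_X]

lemma pderiv_form (j : Fin ℓ) (H : Fin n) : pderiv j (A.form H) = C (A.coeff H j) := by
  simp [form, pderiv_X, Pi.single_apply]

/-- The product of the forms other than `α_H`. -/
def cofactor (H : Fin n) : Poly ℓ := ∏ H' ∈ Finset.univ.erase H, A.form H'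

lemma form_mul_cofactor (H : Fin n) : A.form H * A.cofactor H = A.defEq :=
  Finset.mul_prod_erase _ _ (Finset.mem_univ H)

/-- The vector field `f ∂_i`. -/
def defEqPartial (i : Fin ℓ) : Derivation ℂ (Poly ℓ) (Poly ℓ) := A.defEq • pderiv i

lemma defEqPartial_form (i : Fin ℓ) (H : Fin n) :
    A.defEqPartial i (A.form H) = A.form H * (A.cofactor H * C (A.coeff H i)) := by
  rw [defEqPartial, Derivation.smul_apply, pderiv_form, smul_eq_mul, ← form_mul_cofactor A H,
    mul_assoc]

lemma defEqPartial_mem (i : Fin ℓ) : A.defEqPartial i ∈ A.logDer :=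
  fun H => ⟨_, A.defEqPartial_form i H⟩

/-- The polynomial `⟨f ∂_i, ω_λ⟩`. -/
def omegaCoeff (lam : Fin n → ℂ) (i : Fin ℓ) : Poly ℓ :=
  ∑ H, lam H • (A.cofactor H * C (A.coeff H i))

lemma contract_defEqPartial_omega (lam : Fin n → ℂ) (i : Fin ℓ) :
    contract (A.defEqPartial i) (A.omega lam) =
      algebraMap (Poly ℓ) (RatForm ℓ) (A.omegaCoeff lam i) :=
  A.contract_omega_of_eq_mul (A.defEqPartial_form i) lam

lemma eval_cofactor {v : Fin ℓ → ℂ} (hv : ∀ H, A.eval H v ≠ 0) (H : Fin n) :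
    MvPolynomial.eval v (A.cofactor H) = MvPolynomial.eval v A.defEq / A.eval H v := by
  rw [eq_div_iff (hv H), ← eval_form, ← map_mul, mul_comm, form_mul_cofactor]

lemma eval_omegaCoeff {v : Fin ℓ → ℂ} (hv : ∀ H, A.eval H v ≠ 0) (lam : Fin n → ℂ) (i : Fin ℓ) :
    MvPolynomial.eval v (A.omegaCoeff lam i) =
      MvPolynomial.eval v A.defEq * ∑ H, lam H * (A.coeff H i / A.eval H v) := by
  simp only [omegaCoeff, map_sum, smul_eval, map_mul, eval_C, A.eval_cofactor hv, Finset.mul_sum]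
  exact Finset.sum_congr rfl fun H _ => by ring

lemma eval_single (H : Fin n) (i : Fin ℓ) : A.eval H (Pi.single i 1) = A.coeff H i := by
  simp [Arrangement.eval, Pi.single_apply]

lemma IsCritical.sum_coeff {A : Arrangement ℓ n} {lam : Fin n → ℂ} {v : Fin ℓ → ℂ}
    (h : A.IsCritical lam v) (i : Fin ℓ) : ∑ H, lam H * (A.coeff H i / A.eval H v) = 0 := by
  simpa only [eval_single] using h.2 (Pi.single i 1)

lemma isCritical_of_sum_coeff {lam : Fin n → ℂ} {v : Fin ℓ → ℂ} (hv : ∀ H, A.eval H v ≠ 0)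
    (h : ∀ i, ∑ H, lam H * (A.coeff H i / A.eval H v) = 0) : A.IsCritical lam v := by
  refine ⟨hv, fun a => ?_⟩
  have : ∀ H, lam H * (A.eval H a / A.eval H v) =
      ∑ i, a i * (lam H * (A.coeff H i / A.eval H v)) := by
    intro H
    rw [Arrangement.eval, Finset.sum_div, Finset.mul_sum]
    exact Finset.sum_congr rfl fun i _ => by ring
  simp only [this]
  rw [Finset.sum_comm]
  simp only [← Finset.mul_sum, h, mul_zero, Finset.sum_const_zero]

/-- `omegaCoeff` is $f$ times a coefficient of $\omega_\lambda$. At a critical point the term in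
which $f$ is differentiated vanishes, and the Jacobian is $f(v)$ times the Hessian of
$\log\Phi_\lambda$. -/
lemma eval_pderiv_omegaCoeff {lam : Fin n → ℂ} {v : Fin ℓ → ℂ} (h : A.IsCritical lam v)
    (i j : Fin ℓ) : MvPolynomial.eval v (pderiv j (A.omegaCoeff lam i)) =
      -MvPolynomial.eval v A.defEq *
        ∑ H, lam H * (A.coeff H i * A.coeff H j / A.eval H v ^ 2) := by
  have h1 : ∀ H, MvPolynomial.eval v (pderiv j (A.cofactor H)) =
      MvPolynomial.eval v (pderiv j A.defEq) / A.eval H v -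
        MvPolynomial.eval v A.defEq * A.coeff H j / A.eval H v ^ 2 := by
    intro H
    have h2 := congrArg (fun q => MvPolynomial.eval v (pderiv j q)) (A.form_mul_cofactor H)
    simp only [Derivation.leibniz, pderiv_form, smul_eq_mul, map_add, map_mul, eval_C, eval_form,
      A.eval_cofactor h.1] at h2
    have := h.1 H
    rw [← h2]
    field_simp
    ring
  have h3 : ∀ H, MvPolynomial.eval v (pderiv j (lam H • (A.cofactor H * C (A.coeff H i)))) =
      MvPolynomial.eval v (pderiv j A.defEq) * (lam H * (A.coeff H i / A.eval H v)) +
      -MvPolynomial.eval v A.defEq *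
        (lam H * (A.coeff H i * A.coeff H j / A.eval H v ^ 2)) := by
    intro H
    rw [Derivation.map_smul, Derivation.leibniz, pderiv_C, smul_zero, zero_add, smul_eval,
      smul_eq_mul, map_mul, eval_C, h1]
    ring
  rw [omegaCoeff, map_sum, map_sum]
  simp only [h3, Finset.sum_add_distrib, ← Finset.mul_sum]
  rw [h.sum_coeff i, mul_zero, zero_add]

lemma exists_mem_ideal_of_not_isCritical {lam : Fin n → ℂ} {v : Fin ℓ → ℂ}
    (hv : ∀ H, A.eval H v ≠ 0) (h : ¬ A.IsCritical lam v) :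
    ∃ r ∈ A.ideal lam, MvPolynomial.eval v r ≠ 0 := by
  obtain ⟨i, hi⟩ : ∃ i, ∑ H, lam H * (A.coeff H i / A.eval H v) ≠ 0 := by
    by_contra! h'
    exact h (A.isCritical_of_sum_coeff hv h')
  refine ⟨A.omegaCoeff lam i, Ideal.subset_span ⟨_, A.defEqPartial_mem i,
    A.contract_defEqPartial_omega lam i⟩, ?_⟩
  rw [A.eval_omegaCoeff hv]
  exact mul_ne_zero (A.eval_defEq_ne_zero.mpr hv) hi

-- Let $g$ be the product of the forms not vanishing at $v$. The field $g\sum_i(x_i-v_i)\partial_i$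
-- is logarithmic, since the forms vanishing at $v$ are eigenvectors of the Euler field centred at
-- $v$. Its pairing with $\omega_\lambda$ takes the value $g(v)\sum_{H\ni v}\lambda_H$ at $v$.
open Classical in
lemma exists_mem_ideal_of_sum_ne_zero {lam : Fin n → ℂ} {v : Fin ℓ → ℂ}
    (h : ∑ H with A.eval H v = 0, lam H ≠ 0) :
    ∃ r ∈ A.ideal lam, MvPolynomial.eval v r ≠ 0 := by
  let g : Poly ℓ := ∏ H with A.eval H v ≠ 0, A.form H
  have hg : MvPolynomial.eval v g ≠ 0 := by
    simp only [g, map_prod, eval_form]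
    exact Finset.prod_ne_zero_iff.mpr fun H hH => (Finset.mem_filter.mp hH).2
  let δ : Derivation ℂ (Poly ℓ) (Poly ℓ) := mkDerivation ℂ fun i => g * (X i - C (v i))
  have hδ : ∀ H, δ (A.form H) = g * (A.form H - C (A.eval H v)) := by
    intro H
    simp only [δ, mkDerivation_form]
    simp only [form, Arrangement.eval, map_sum, map_mul, ← Finset.sum_sub_distrib, Finset.mul_sum]
    exact Finset.sum_congr rfl fun i _ => by ring
  have hmem : δ ∈ A.logDer := by
    intro H
    rw [hδ]
    by_cases h0 : A.eval H v = 0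
    · rw [h0, map_zero, sub_zero]; exact dvd_mul_left _ _
    · exact (Finset.dvd_prod_of_mem _ (by simp [h0])).mul_right _
  choose c hc using hmem
  refine ⟨_, Ideal.subset_span ⟨δ, fun H => ⟨c H, hc H⟩, A.contract_omega_of_eq_mul hc lam⟩, ?_⟩
  have hcv : ∀ H, MvPolynomial.eval v (c H) =
      if A.eval H v = 0 then MvPolynomial.eval v g else 0 := by
    intro H
    have h1 := hc H
    rw [hδ] at h1
    split_ifs with h0
    · rw [h0, map_zero, sub_zero, mul_comm] at h1
      rw [mul_left_cancel₀ (A.form_ne_zero H) h1]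
    · have h2 := congrArg (MvPolynomial.eval v) h1
      simp only [map_mul, map_sub, eval_form, eval_C, sub_self, mul_zero] at h2
      exact (mul_eq_zero.mp h2.symm).resolve_left h0
  rw [map_sum]
  simp only [smul_eval, hcv, mul_ite, mul_zero]
  rw [← Finset.sum_filter, ← Finset.sum_mul]
  exact mul_ne_zero h hg

end Arrangement

end LogForms

/-! ### Forms regular at a point, and the perturbed differential. -/

namespace LogForms

open MvPolynomial

variable {ℓ : ℕ}

instance (v : Fin ℓ → ℂ) : (pointIdeal v).IsPrime := RingHom.ker_isPrime _

lemma mem_primeCompl_pointIdeal {v : Fin ℓ → ℂ} {r : Poly ℓ} :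
    r ∈ (pointIdeal v).primeCompl ↔ MvPolynomial.eval v r ≠ 0 := Iff.rfl

/-- The rational forms that are regular at the point `v`. -/
def locForms (v : Fin ℓ → ℂ) (p : ℕ) : Submodule (Poly ℓ) (RatForm ℓ) where
  carrier := {w | ∃ r : Poly ℓ, MvPolynomial.eval v r ≠ 0 ∧ r • w ∈ polyForms ℓ p}
  zero_mem' := ⟨1, by simp, by simp⟩
  add_mem' := by
    rintro a b ⟨r, hr, ha⟩ ⟨s, hs, hb⟩
    refine ⟨r * s, by simp [hr, hs], ?_⟩
    rw [smul_add]
    refine add_mem ?_ ?_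
    · rw [mul_comm, mul_smul]; exact Submodule.smul_mem _ _ ha
    · rw [mul_smul]; exact Submodule.smul_mem _ _ hb
  smul_mem' := by
    rintro c a ⟨r, hr, ha⟩
    exact ⟨r, hr, by rw [smul_comm]; exact Submodule.smul_mem _ _ ha⟩

lemma polyForms_le_locForms (v : Fin ℓ → ℂ) (p : ℕ) : polyForms ℓ p ≤ locForms v p :=
  fun w hw => ⟨1, by simp, by simpa using hw⟩

lemma mem_locForms_of_smul_mem {v : Fin ℓ → ℂ} {p : ℕ} {r : Poly ℓ}
    (hr : MvPolynomial.eval v r ≠ 0) {w : RatForm ℓ} (h : r • w ∈ locForms v p) :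
    w ∈ locForms v p := by
  obtain ⟨s, hs, h⟩ := h
  exact ⟨s * r, by simp [hr, hs], by rwa [mul_smul]⟩

lemma exists_smul_eq {v : Fin ℓ → ℂ} {p : ℕ} {r : Poly ℓ}
    (hr : MvPolynomial.eval v r ≠ 0) {w : RatForm ℓ} (hw : w ∈ locForms v p) :
    ∃ u ∈ locForms v p, r • u = w := by
  have hr0 : algebraMap (Poly ℓ) (RatFun ℓ) r ≠ 0 := by
    intro h
    rw [map_eq_zero_iff _ (IsFractionRing.injective (Poly ℓ) (RatFun ℓ))] at h
    simp [h] at hr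
  have h : r • ((algebraMap (Poly ℓ) (RatFun ℓ) r)⁻¹ • w) = w := by
    rw [← algebraMap_smul (RatFun ℓ) r, smul_smul, mul_inv_cancel₀ hr0, one_smul]
  exact ⟨_, mem_locForms_of_smul_mem hr (by rwa [h]), h⟩

instance (p : ℕ) : Module.Free (Poly ℓ) (polyForms ℓ p) :=
  have : Module.Free (Poly ℓ) (⋀[Poly ℓ]^p (Fin ℓ → Poly ℓ)) :=
    Module.Free.of_basis ((Pi.basisFun (Poly ℓ) (Fin ℓ)).exteriorPower p)
  Module.Free.of_equiv (Submodule.equivMapOfInjective (polyIncl ℓ).toLinearMap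
    (Arrangement.polyIncl_injective ℓ) (⋀[Poly ℓ]^p (Fin ℓ → Poly ℓ)))

instance (v : Fin ℓ → ℂ) (p : ℕ) : IsLocalizedModule (pointIdeal v).primeCompl
    (Submodule.inclusion (polyForms_le_locForms v p)) where
  map_units := by
    rintro ⟨r, hr⟩
    rw [mem_primeCompl_pointIdeal] at hr
    rw [Module.End.isUnit_iff]
    have hr0 : r ≠ 0 := by rintro rfl; simp at hr
    constructor
    · intro x y h
      exact Subtype.ext (smul_right_injective_ratForm hr0 (congrArg Subtype.val h))
    · rintro ⟨w, hw⟩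
      obtain ⟨u, hu, h⟩ := exists_smul_eq hr hw
      exact ⟨⟨u, hu⟩, Subtype.ext h⟩
  surj := by
    rintro ⟨w, r, hr, hw⟩
    exact ⟨⟨⟨r • w, hw⟩, ⟨r, hr⟩⟩, rfl⟩
  exists_of_eq := by
    intro x y h
    refine ⟨1, ?_⟩
    rw [one_smul, one_smul]
    exact Submodule.inclusion_injective _ h

open RingTheory.Sequence in
-- The module is a localization of a free module, and the $\ell$ coordinates centred at $v$ stay
-- weakly regular under localization.
lemma extVanishes_locForms (v : Fin ℓ → ℂ) (p : ℕ) {j : ℕ} (hj : j < ℓ) :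
    ExtVanishes (R := Poly ℓ) (Poly ℓ ⧸ pointIdeal v) (locForms v p) j := by
  set rs := List.ofFn fun i : Fin ℓ => (X i - C (v i) : Poly ℓ) with hrs
  have h1 : IsWeaklyRegular (Poly ℓ) rs := isWeaklyRegular_X_sub_C ℓ v
  have h2 : IsWeaklyRegular (polyForms ℓ p) rs :=
    ((TensorProduct.rid (Poly ℓ) (polyForms ℓ p)).isWeaklyRegular_congr rs).mp
      h1.isWeaklyRegular_lTensor
  have h3 := h2.of_isLocalizedModule (Localization (pointIdeal v).primeCompl)
    (pointIdeal v).primeCompl (LocalizedModule.mkLinearMap (pointIdeal v).primeCompl _)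
  rw [isWeaklyRegular_map_algebraMap_iff] at h3
  have h4 := ((IsLocalizedModule.iso (pointIdeal v).primeCompl
    (Submodule.inclusion (polyForms_le_locForms v p))).isWeaklyRegular_congr rs).mp h3
  refine ExtVanishes.of_isWeaklyRegular rs h4 ?_ (by simpa [hrs] using hj)
  intro r hr
  rw [hrs, List.mem_ofFn] at hr
  obtain ⟨i, rfl⟩ := hr
  exact ⟨1, by rw [pow_one, Ideal.annihilator_quotient]; exact X_sub_C_mem_pointIdeal v i⟩

lemma contract_mem_locForms (δ : Derivation ℂ (Poly ℓ) (Poly ℓ)) {v : Fin ℓ → ℂ} {p : ℕ}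
    {w : RatForm ℓ} (hw : w ∈ locForms v (p + 1)) : contract δ w ∈ locForms v p := by
  obtain ⟨r, hr, hw⟩ := hw
  exact ⟨r, hr, by rw [← contract_smul]; exact contract_mem δ hw⟩

lemma contract_eq_zero_of_mem_locForms (δ : Derivation ℂ (Poly ℓ) (Poly ℓ)) {v : Fin ℓ → ℂ}
    {w : RatForm ℓ} (hw : w ∈ locForms v 0) : contract δ w = 0 := by
  obtain ⟨r, hr, hw⟩ := hw
  have hr0 : r ≠ 0 := by rintro rfl; simp at hr
  apply smul_right_injective_ratForm hr0
  simp only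
  rw [← contract_smul, contract_eq_zero δ hw, smul_zero]

namespace Arrangement

variable {n : ℕ} (A : Arrangement ℓ n)

lemma logForms_le_locForms {v : Fin ℓ → ℂ} (hv : ∀ H, A.eval H v ≠ 0) (p : ℕ) :
    A.logForms p ≤ locForms v p :=
  fun _ hw => ⟨A.defEq, A.eval_defEq_ne_zero.mpr hv, hw.1⟩

lemma dlog_mul_mem_locForms {v : Fin ℓ → ℂ} {H : Fin n} (hv : A.eval H v ≠ 0) {p : ℕ}
    {w : RatForm ℓ} (hw : w ∈ locForms v p) : A.dlog H * w ∈ locForms v (p + 1) := by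
  obtain ⟨r, hr, hw⟩ := hw
  refine ⟨r * A.form H, by simp [hr, eval_form, hv], ?_⟩
  rw [mul_smul, ← smul_mul_assoc (A.form H), form_smul_dlog, ← mul_smul_comm]
  exact A.dvec_mul_mem_polyForms H hw

lemma omega_mul_mem_locForms (lam : Fin n → ℂ) {v : Fin ℓ → ℂ} (hv : ∀ H, A.eval H v ≠ 0) {p : ℕ}
    {w : RatForm ℓ} (hw : w ∈ locForms v p) : A.omega lam * w ∈ locForms v (p + 1) := by
  rw [omega, Finset.sum_mul]
  refine sum_mem fun H _ => ?_
  rw [smul_mul_assoc, ← algebraMap_smul (Poly ℓ) (lam H)]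
  exact Submodule.smul_mem _ _ (A.dlog_mul_mem_locForms (hv H) hw)

lemma smul_mem_logForms_of_mem_polyForms {p : ℕ} {w : RatForm ℓ} (hw : w ∈ polyForms ℓ p) :
    w ∈ A.logForms p := by
  refine ⟨Submodule.smul_mem _ _ hw, fun H => ?_⟩
  rw [← form_mul_cofactor A H, mul_comm, mul_smul, ← smul_mul_assoc, form_smul_dlog]
  exact Submodule.smul_mem _ _ (A.dvec_mul_mem_polyForms H hw)

/-- Polynomial forms are logarithmic, so it is enough to clear a denominator that is invertible at
$v$. -/
lemma exists_smul_mem_relForms {v : Fin ℓ → ℂ} {p : ℕ} {w : RatForm ℓ} (hw : w ∈ locForms v p)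
    (hw0 : contract (euler ℓ) w = 0) :
    ∃ r : Poly ℓ, MvPolynomial.eval v r ≠ 0 ∧ r • w ∈ A.relForms p := by
  obtain ⟨r, hr, hw⟩ := hw
  refine ⟨r, hr, A.smul_mem_logForms_of_mem_polyForms hw, ?_⟩
  change contract (euler ℓ) (r • w) = 0
  rw [contract_smul, hw0, smul_zero]

lemma omega_mul_dlog (lam : Fin n → ℂ) (H : Fin n) :
    A.omega lam * A.dlog H = -(A.dlog H * A.omega lam) := by
  rw [omega_eq]
  exact eq_neg_of_add_eq_zero_left (ExteriorAlgebra.ι_add_mul_swap _ _)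

/-- The form `ω_λ + h dα_H/α_H`. -/
def perturbed (lam : Fin n → ℂ) (H : Fin n) (h : Poly ℓ) : RatForm ℓ :=
  A.omega lam + h • A.dlog H

variable (lam : Fin n → ℂ) (H : Fin n) (h : Poly ℓ)

lemma perturbed_mul (x : RatForm ℓ) : A.perturbed lam H h * x =
    A.omega lam * x + h • (A.dlog H * x) := by
  rw [perturbed, add_mul, smul_mul_assoc]

lemma perturbed_mul_self : A.perturbed lam H h * A.perturbed lam H h = 0 := by
  simp only [perturbed, add_mul, mul_add, smul_mul_assoc, mul_smul_comm, omega_mul_self,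
    dlog_mul_self, omega_mul_dlog, smul_zero, zero_add, add_zero, smul_neg]
  abel

lemma contract_perturbed_mul {δ : Derivation ℂ (Poly ℓ) (Poly ℓ)} {r c : Poly ℓ}
    (hr : contract δ (A.omega lam) = algebraMap (Poly ℓ) (RatForm ℓ) r)
    (hc : δ (A.form H) = A.form H * c) (x : RatForm ℓ) :
    contract δ (A.perturbed lam H h * x) =
      (r + h * c) • x - A.perturbed lam H h * contract δ x := by
  rw [perturbed_mul, map_add, contract_smul, A.contract_omega_mul hr, contract_dlog_mul, hc,
    map_mul (algebraMap _ _), mul_div_cancel_left₀ _ (A.algebraMap_form_ne_zero H),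
    algebraMap_smul, perturbed_mul, smul_sub, add_smul, mul_smul]
  abel

lemma contract_euler_omega_eq_zero (hlam : ∑ H, lam H = 0) :
    contract (euler ℓ) (A.omega lam) = algebraMap (Poly ℓ) (RatForm ℓ) 0 := by
  rw [contract_euler_omega, hlam, map_zero, map_zero]

end Arrangement

end LogForms

/-! ### Vanishing near nondegenerate critical points. -/

namespace LogForms

open MvPolynomial

variable {ℓ : ℕ}

namespace Arrangement

variable {n : ℕ} (A : Arrangement ℓ n)

lemma coboundaries_eq_boundaries (lam : Fin n → ℂ) (p : ℕ) : A.coboundaries lam p =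
    boundaries A.relForms (LinearMap.mulLeft (Poly ℓ) (A.omega lam)) p := by
  cases p <;> rfl

section Perturbed

variable {A} {lam : Fin n → ℂ} {H₀ : Fin n} {v : Fin ℓ → ℂ} {h : Poly ℓ}

lemma mem_boundaries_perturbed_of_smul_mem {s : Poly ℓ} (hs : MvPolynomial.eval v s ≠ 0) {p : ℕ}
    {w : RatForm ℓ} (hw : s • w ∈ boundaries (locForms v)
      (LinearMap.mulLeft (Poly ℓ) (A.perturbed lam H₀ h)) p) :
    w ∈ boundaries (locForms v) (LinearMap.mulLeft (Poly ℓ) (A.perturbed lam H₀ h)) p := by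
  have hs0 : s ≠ 0 := by rintro rfl; simp at hs
  cases p with
  | zero => exact smul_right_injective_ratForm hs0 (hw.trans (smul_zero _).symm)
  | succ p =>
    obtain ⟨u, hu, huw⟩ := hw
    obtain ⟨u', hu', rfl⟩ := exists_smul_eq hs hu
    refine ⟨u', hu', smul_right_injective_ratForm hs0 ?_⟩
    simpa using huw

lemma smul_mem_boundaries_perturbed {δ : Derivation ℂ (Poly ℓ) (Poly ℓ)} {r c : Poly ℓ}
    (hr : contract δ (A.omega lam) = algebraMap (Poly ℓ) (RatForm ℓ) r)
    (hc : δ (A.form H₀) = A.form H₀ * c) {p : ℕ} {z : RatForm ℓ} (hz : z ∈ locForms v p)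
    (hηz : A.perturbed lam H₀ h * z = 0) : (r + h * c) • z ∈ boundaries (locForms v)
      (LinearMap.mulLeft (Poly ℓ) (A.perturbed lam H₀ h)) p := by
  have h1 := A.contract_perturbed_mul lam H₀ h hr hc z
  rw [hηz, map_zero, eq_comm, sub_eq_zero] at h1
  rw [h1]
  cases p with
  | zero => rw [contract_eq_zero_of_mem_locForms δ hz, mul_zero]; exact zero_mem _
  | succ p => exact ⟨_, contract_mem_locForms δ hz, rfl⟩

/-- At a nondegenerate critical point the coefficients of `ω_λ` and a function `h` that is
transverse to the critical line generate the maximal ideal, up to its square. -/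
lemma pointIdeal_le_sup (hcrit : A.IsCritical lam v) (hnd : A.IsNondegenerateAt lam v)
    {j : Fin ℓ} (hj : v j ≠ 0) :
    pointIdeal v ≤ (Ideal.span (insert (X j - C (v j)) (Set.range (A.omegaCoeff lam)))) ⊔
      pointIdeal v • pointIdeal v := by
  intro q hq
  let G : Fin ℓ → Fin ℓ → ℂ := fun i k => MvPolynomial.eval v (pderiv k (A.omegaCoeff lam i))
  let e : Fin ℓ → ℂ := Pi.single j 1
  -- The gradients of the coefficients annihilate only the line $\mathbb Cv$, by nondegeneracy; the
  -- gradient $e_j$ of $h$ does not annihilate $v$, since $v_j\ne0$. So together they span.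
  have hspan : Submodule.span ℂ (insert e (Set.range G)) = ⊤ := by
    by_contra hne
    obtain ⟨φ, hφ0, hφ⟩ := Submodule.exists_le_ker_of_lt_top _ (lt_top_iff_ne_top.mpr hne)
    rw [Submodule.span_le] at hφ
    let a : Fin ℓ → ℂ := fun k => φ (Pi.single k 1)
    have hφa : ∀ x, φ x = ∑ k, x k * a k := by
      intro x
      conv_lhs => rw [pi_eq_sum_univ' x]
      simp [map_sum, a]
    have hG : ∀ i, ∑ k, G i k * a k = 0 := fun i => by
      rw [← hφa]; exact hφ (Set.mem_insert_of_mem _ ⟨i, rfl⟩)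
    have hf := A.eval_defEq_ne_zero.mpr hcrit.1
    have hess : ∀ i, ∑ H, lam H * (A.eval H a * A.coeff H i / A.eval H v ^ 2) = 0 := by
      intro i
      have h1 := hG i
      simp only [G, A.eval_pderiv_omegaCoeff hcrit, mul_assoc] at h1
      rw [← Finset.mul_sum, mul_eq_zero] at h1
      have h2 := h1.resolve_left (neg_ne_zero.mpr hf)
      rw [← h2]
      simp only [Finset.sum_mul]
      rw [Finset.sum_comm]
      refine Finset.sum_congr rfl fun H _ => ?_
      rw [Arrangement.eval, Finset.sum_mul, Finset.sum_div, Finset.mul_sum]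
      exact Finset.sum_congr rfl fun k _ => by ring
    obtain ⟨t, ht⟩ := Submodule.mem_span_singleton.mp (hnd a (by
      intro b
      have : ∀ H, lam H * (A.eval H a * A.eval H b / A.eval H v ^ 2) =
          ∑ i, b i * (lam H * (A.eval H a * A.coeff H i / A.eval H v ^ 2)) := by
        intro H
        rw [show A.eval H b = ∑ i, A.coeff H i * b i from rfl, Finset.mul_sum, Finset.sum_div,
          Finset.mul_sum]
        exact Finset.sum_congr rfl fun i _ => by ring
      simp only [this]
      rw [Finset.sum_comm]
      simp only [← Finset.mul_sum, hess, mul_zero, Finset.sum_const_zero]))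
    have haj : a j = 0 := hφ (Set.mem_insert _ _)
    have ht0 : t = 0 := by
      rw [← ht] at haj
      exact (mul_eq_zero.mp haj).resolve_right hj
    apply hφ0
    ext k
    have : a k = 0 := by rw [← ht, ht0]; simp
    simpa [a] using this
  have hgrad : (fun k => MvPolynomial.eval v (pderiv k q)) ∈
      Submodule.span ℂ (insert e (Set.range G)) := by rw [hspan]; trivial
  obtain ⟨t, y, hy, hty⟩ := Submodule.mem_span_insert.mp hgrad
  obtain ⟨c, hc⟩ := (Submodule.mem_span_range_iff_exists_fun ℂ).mp hy
  -- This combination vanishes at $v$ and has there the same gradient as $q$.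
  set g : Poly ℓ := C t * (X j - C (v j)) + ∑ i, C (c i) * A.omegaCoeff lam i with hg
  have hgmem : g ∈ Ideal.span (insert (X j - C (v j)) (Set.range (A.omegaCoeff lam))) := by
    refine add_mem (Ideal.mul_mem_left _ _ (Ideal.subset_span (Set.mem_insert _ _))) ?_
    exact sum_mem fun i _ => Ideal.mul_mem_left _ _
      (Ideal.subset_span (Set.mem_insert_of_mem _ ⟨i, rfl⟩))
  have hq' : q - g ∈ pointIdeal v • pointIdeal v := by
    refine mem_sq_of_pderiv ?_ ?_
    · have hP : ∀ i, MvPolynomial.eval v (A.omegaCoeff lam i) = 0 := fun i => by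
        rw [A.eval_omegaCoeff hcrit.1, hcrit.sum_coeff, mul_zero]
      have hq0 : MvPolynomial.eval v q = 0 := hq
      simp [hg, hq0, hP]
    · intro k
      have h1 := congrFun hty k
      simp only [Pi.add_apply, Pi.smul_apply, ← hc, Finset.sum_apply, smul_eq_mul, e, G] at h1
      simp only [hg, map_sub, map_add, map_sum, Derivation.leibniz, pderiv_C,
        smul_eq_mul, map_mul, eval_C, pderiv_X, h1, sub_zero]
      by_cases hjk : j = k
      · subst hjk; simp
      · simp [hjk, Ne.symm hjk]
  have := add_mem (Submodule.mem_sup_left hgmem) (Submodule.mem_sup_right hq') (S := _)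
  rwa [add_sub_cancel] at this

lemma eval_ne_zero_of_sub_one_mem {s : Poly ℓ} (hs : s - 1 ∈ pointIdeal v) :
    MvPolynomial.eval v s ≠ 0 := by
  rw [RingHom.mem_ker, map_sub, map_one, sub_eq_zero] at hs
  rw [hs]; exact one_ne_zero

lemma exists_smul_pointIdeal_le (hcrit : A.IsCritical lam v) (hnd : A.IsNondegenerateAt lam v)
    {j : Fin ℓ} (hj : v j ≠ 0) : ∃ s : Poly ℓ, MvPolynomial.eval v s ≠ 0 ∧ ∀ r ∈ pointIdeal v,
      s * r ∈ Ideal.span (insert (X j - C (v j)) (Set.range (A.omegaCoeff lam))) := by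
  have h1 : (pointIdeal v).FG := (isNoetherianRing_iff_ideal_fg _).mp inferInstance _
  obtain ⟨s, hs, hsle⟩ := Submodule.exists_sub_one_mem_and_smul_le_of_fg_of_le_sup h1 le_rfl
    (pointIdeal_le_sup hcrit hnd hj)
  exact ⟨s, eval_ne_zero_of_sub_one_mem hs,
    fun r hr => hsle (Submodule.smul_mem_pointwise_smul r s _ hr)⟩

/-- Contraction with $\chi$ shows that $h$ kills the local cohomology, as
$\iota_\chi\omega_\lambda=0$; contraction with $f\partial_i$ then shows that `omegaCoeff` does. Up
to a unit at $v$ these generate the maximal ideal, and the acyclicity lemma applies with the full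
depth $\ell$. -/
lemma perturbed_exact (hlam : ∑ H, lam H = 0) (hcrit : A.IsCritical lam v)
    (hnd : A.IsNondegenerateAt lam v) {j : Fin ℓ} (hj : v j ≠ 0) :
    ∀ p < ℓ, ∀ z ∈ locForms v p, A.perturbed lam H₀ (X j - C (v j)) * z = 0 →
      z ∈ boundaries (locForms v)
        (LinearMap.mulLeft (Poly ℓ) (A.perturbed lam H₀ (X j - C (v j)))) p := by
  set h : Poly ℓ := X j - C (v j)
  refine mem_boundaries_of_extVanishes (locForms v)
    (LinearMap.mulLeft (Poly ℓ) (A.perturbed lam H₀ h)) ?_ ?_ (pointIdeal v) ℓ ?_ ?_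
  · intro p x hx
    rw [LinearMap.mulLeft_apply, perturbed_mul]
    exact add_mem (A.omega_mul_mem_locForms lam hcrit.1 hx)
      (Submodule.smul_mem _ _ (A.dlog_mul_mem_locForms (hcrit.1 H₀) hx))
  · intro x
    rw [LinearMap.mulLeft_apply, LinearMap.mulLeft_apply, ← mul_assoc, perturbed_mul_self,
      zero_mul]
  · intro p k hk
    exact extVanishes_locForms v p (by omega)
  · intro p hp z hz hηz r hr
    obtain ⟨s, hsv, hsle⟩ := exists_smul_pointIdeal_le hcrit hnd hj
    apply mem_boundaries_perturbed_of_smul_mem hsv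
    rw [smul_smul]
    have hh : h • z ∈ boundaries (locForms v)
        (LinearMap.mulLeft (Poly ℓ) (A.perturbed lam H₀ h)) p := by
      have := smul_mem_boundaries_perturbed (c := 1) (A.contract_euler_omega_eq_zero lam hlam)
        (by rw [euler_form, mul_one]) hz hηz
      rwa [mul_one, zero_add] at this
    have hmem : s * r ∈ Ideal.span (insert h (Set.range (A.omegaCoeff lam))) :=
      hsle r hr
    generalize s * r = q at hmem
    induction hmem using Submodule.span_induction with
    | mem q hq =>
      rcases hq with rfl | ⟨i, rfl⟩
      · exact hh
      · have h1 := smul_mem_boundaries_perturbed (A.contract_defEqPartial_omega lam i)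
          (A.defEqPartial_form i H₀) hz hηz
        have h2 := sub_mem h1 (Submodule.smul_mem _ (A.cofactor H₀ * C (A.coeff H₀ i)) hh)
        rwa [add_smul, smul_smul, mul_comm h, add_sub_cancel_right] at h2
    | zero => rw [zero_smul]; exact zero_mem _
    | add a b _ _ ha hb => rw [add_smul]; exact add_mem ha hb
    | smul a q _ hq => rw [smul_assoc]; exact Submodule.smul_mem _ _ hq

/-- Near a nondegenerate critical point every cocycle below the top degree is a multiple of a
cocycle by `h`, up to a coboundary. -/
lemma exists_local_decomposition (hlam : ∑ H, lam H = 0) (hcrit : A.IsCritical lam v)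
    (hnd : A.IsNondegenerateAt lam v) (H₀ : Fin n) {j : Fin ℓ} (hj : v j ≠ 0) {p : ℕ}
    (hp : p + 1 < ℓ) {z : RatForm ℓ} (hz : z ∈ A.relForms p) (hωz : A.omega lam * z = 0) :
    ∃ r : Poly ℓ, MvPolynomial.eval v r ≠ 0 ∧ ∃ u ∈ A.cocycles lam p,
      r • z - (X j - C (v j)) • u ∈ A.coboundaries lam p := by
  set h : Poly ℓ := X j - C (v j)
  -- Multiplication by $d\alpha_{H_0}/\alpha_{H_0}$ turns cocycles of $\omega_\lambda$ into cocycles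
  -- of the perturbed form, one degree higher; this is where $p+1<\ell$ is needed.
  have h1 : A.perturbed lam H₀ h * (A.dlog H₀ * z) = 0 := by
    rw [perturbed_mul, ← mul_assoc, omega_mul_dlog, neg_mul, mul_assoc, hωz, ← mul_assoc,
      dlog_mul_self]
    simp
  obtain ⟨u, hu, huz⟩ := perturbed_exact (H₀ := H₀) hlam hcrit hnd hj (p + 1) hp _
    (A.dlog_mul_mem_locForms (hcrit.1 H₀) (A.logForms_le_locForms hcrit.1 p hz.1)) h1
  rw [LinearMap.mulLeft_apply] at huz
  set u₁ := contract (euler ℓ) u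
  set u₀ := contract (euler ℓ) (A.dlog H₀ * u) with hu₀
  have hu₀' : u₀ = u - A.dlog H₀ * u₁ := A.contract_euler_dlog_mul H₀ u
  have hχω : ∀ x, contract (euler ℓ) (A.omega lam * x) =
      -(A.omega lam * contract (euler ℓ) x) := by
    intro x
    rw [A.contract_omega_mul (A.contract_euler_omega_eq_zero lam hlam), zero_smul, zero_sub]
  -- Apply $\iota_\chi$ to $\frac{d\alpha_{H_0}}{\alpha_{H_0}}\wedge
  -- z=(\omega_\lambda+h\frac{d\alpha_{H_0}}{\alpha_{H_0}})\wedge u$.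
  have hz' : z = h • u₀ - A.omega lam * u₁ := by
    have h2 := A.contract_euler_dlog_mul_of_mem_relForms H₀ hz
    rw [← huz, perturbed_mul, map_add, contract_smul, hχω] at h2
    rw [← h2]
    abel
  -- Multiplying the same equation by $d\alpha_{H_0}/\alpha_{H_0}$ leaves
  -- $\frac{d\alpha_{H_0}}{\alpha_{H_0}}\wedge\omega_\lambda\wedge u=0$; then contract with $\chi$.
  have hωu₀ : A.omega lam * u₀ = 0 := by
    have h3 : A.dlog H₀ * (A.omega lam * u) = 0 := by
      have := congrArg (A.dlog H₀ * ·) huz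
      simpa only [perturbed_mul, mul_add, mul_smul_comm, ← mul_assoc, dlog_mul_self, zero_mul,
        smul_zero, add_zero] using this
    have h4 := congrArg (contract (euler ℓ)) h3
    rw [map_zero, contract_euler_dlog_mul, hχω] at h4
    rw [hu₀', mul_sub, ← mul_assoc, omega_mul_dlog, neg_mul, mul_assoc, ← mul_neg]
    exact h4
  have hu₀loc : u₀ ∈ locForms v p :=
    contract_mem_locForms _ (A.dlog_mul_mem_locForms (hcrit.1 H₀) hu)
  obtain ⟨r, hr, hru⟩ := A.exists_smul_mem_relForms hu₀loc (contract_contract_self _ _)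
  have hcoc : ∀ s : Poly ℓ, (s * r) • u₀ ∈ A.cocycles lam p := by
    intro s
    rw [mul_smul]
    refine ⟨Submodule.smul_mem _ _ hru, ?_⟩
    change A.omega lam * (s • r • u₀) = 0
    rw [mul_smul_comm, mul_smul_comm, hωu₀, smul_zero, smul_zero]
  cases p with
  | zero =>
    refine ⟨r, hr, (1 * r) • u₀, hcoc 1, ?_⟩
    have hu₁ : u₁ = 0 := contract_eq_zero_of_mem_locForms _ hu
    rw [hz', hu₁, mul_zero, sub_zero, one_mul, smul_comm, sub_self]
    exact zero_mem _
  | succ p =>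
    obtain ⟨s, hs, hsu⟩ := A.exists_smul_mem_relForms (contract_mem_locForms (euler ℓ) hu)
      (contract_contract_self _ _)
    refine ⟨s * r, by simp [hs, hr], (s * r) • u₀, hcoc s, ?_⟩
    refine ⟨-(r • s • u₁), neg_mem (Submodule.smul_mem _ _ hsu), ?_⟩
    rw [LinearMap.mulLeft_apply, hz', smul_sub, smul_comm h, mul_neg, mul_smul_comm,
      mul_smul_comm, smul_smul r s, mul_comm r s]
    abel

end Perturbed

instance (p : ℕ) : Module.Finite (Poly ℓ) (polyForms ℓ p) := by
  rw [Module.Finite.iff_fg, polyForms_eq_span]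
  exact Submodule.fg_span (Set.finite_range _)

instance (p : ℕ) : IsNoetherian (Poly ℓ) (A.logForms p) := by
  have : IsNoetherian (Poly ℓ) (polyForms ℓ p) := inferInstance
  let φ : A.logForms p →ₗ[Poly ℓ] polyForms ℓ p :=
    ((LinearMap.lsmul (Poly ℓ) (RatForm ℓ) A.defEq).comp (A.logForms p).subtype).codRestrict _
      fun w => w.2.1
  exact isNoetherian_of_injective φ fun x y h =>
    Subtype.ext (smul_right_injective_ratForm A.defEq_ne_zero (congrArg Subtype.val h))

lemma fg_of_le_logForms {p : ℕ} {N : Submodule (Poly ℓ) (RatForm ℓ)} (hN : N ≤ A.logForms p) :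
    N.FG :=
  isNoetherian_submodule.mp inferInstance N hN

/-- The cohomology below the top degree vanishes near nondegenerate critical points. -/
lemma exists_smul_mem_coboundaries_of_isCritical {lam : Fin n → ℂ} {v : Fin ℓ → ℂ}
    (hlam : ∑ H, lam H = 0) (hcrit : A.IsCritical lam v)
    (hnd : A.IsNondegenerateAt lam v) (H₀ : Fin n) (hv : v ≠ 0) {p : ℕ} (hp : p + 1 < ℓ) :
    ∃ r : Poly ℓ, MvPolynomial.eval v r ≠ 0 ∧
      ∀ z ∈ A.cocycles lam p, r • z ∈ A.coboundaries lam p := by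
  obtain ⟨j, hj⟩ : ∃ j, v j ≠ 0 := by
    by_contra! h; exact hv (funext h)
  -- The unit $r$ at $v$ can be replaced by the constant $r(v)$ modulo the maximal ideal; Nakayama
  -- then finishes.
  have hle : A.cocycles lam p ≤ A.coboundaries lam p ⊔ pointIdeal v • A.cocycles lam p := by
    intro z hz
    obtain ⟨r, hr, u, hu, huz⟩ := exists_local_decomposition hlam hcrit hnd H₀ hj hp hz.1 hz.2
    have h1 : r • z ∈ A.coboundaries lam p ⊔ pointIdeal v • A.cocycles lam p := by
      have := add_mem (Submodule.mem_sup_left huz) (Submodule.mem_sup_right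
        (Submodule.smul_mem_smul (X_sub_C_mem_pointIdeal v j) hu))
      rwa [sub_add_cancel] at this
    have h2 : (r - C (MvPolynomial.eval v r)) • z ∈
        A.coboundaries lam p ⊔ pointIdeal v • A.cocycles lam p :=
      Submodule.mem_sup_right (Submodule.smul_mem_smul (sub_C_eval_mem_pointIdeal v r) hz)
    have h3 := Submodule.smul_mem _ (C (MvPolynomial.eval v r)⁻¹ : Poly ℓ) (sub_mem h1 h2)
    rwa [← sub_smul, sub_sub_cancel, smul_smul, ← map_mul, inv_mul_cancel₀ hr, map_one,
      one_smul] at h3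
  obtain ⟨s, hs, hsle⟩ := Submodule.exists_sub_one_mem_and_smul_le_of_fg_of_le_sup
    (A.fg_of_le_logForms (inf_le_left.trans inf_le_left)) (le_refl _) hle
  exact ⟨s, eval_ne_zero_of_sub_one_mem hs,
    fun z hz => hsle (Submodule.smul_mem_pointwise_smul z s _ hz)⟩

end Arrangement

end LogForms

/-! ### Vanishing below the top degree. -/

namespace LogForms

open MvPolynomial

variable {ℓ : ℕ}

namespace Arrangement

variable {n : ℕ} (A : Arrangement ℓ n)

variable {A} in
lemma Essential.eq_zero (hess : A.Essential) {v : Fin ℓ → ℂ} (hv : ∀ H, A.eval H v = 0) :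
    v = 0 := by
  let φ : (Fin ℓ → ℂ) →ₗ[ℂ] ℂ := ∑ i, v i • LinearMap.proj i
  have hφ : ∀ a, φ a = ∑ i, a i * v i := fun a => by simp [φ, mul_comm]
  have h : Submodule.span ℂ (Set.range A.coeff) ≤ LinearMap.ker φ := by
    rw [Submodule.span_le]
    rintro _ ⟨H, rfl⟩
    exact (hφ _).trans (hv H)
  rw [hess] at h
  funext i
  have := h (Submodule.mem_top (x := Pi.single i 1))
  rw [LinearMap.mem_ker, hφ] at this
  simpa [Pi.single_apply] using this

/-- For $p\ge1$, $\operatorname{pd}\Omega^p(\mathcal A)\le p+1$ leaves depth at least $\ell-p-1$,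
inherited by the direct summand $\Omega^p_0$. Tameness says nothing about $p=0$, but there
$\Omega^0_0=R$. -/
lemma extVanishes_relForms (H₀ : Fin n) (htame : A.AlmostTame) (J : Ideal (Poly ℓ))
    (hJ : ∀ i, ∃ k, (X i : Poly ℓ) ^ k ∈ J) {p j : ℕ} (hp : p ≤ ℓ) (hj : j + p + 1 < ℓ) :
    ExtVanishes (R := Poly ℓ) (Poly ℓ ⧸ J) (A.relForms p) j := by
  set rs := List.ofFn fun i : Fin ℓ => (X i - C ((0 : Fin ℓ → ℂ) i) : Poly ℓ) with hrs
  have h1 : RingTheory.Sequence.IsWeaklyRegular (Poly ℓ) rs := isWeaklyRegular_X_sub_C ℓ 0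
  have h2 : ∀ r ∈ rs, ∃ k, r ^ k ∈ Module.annihilator (Poly ℓ) (Poly ℓ ⧸ J) := by
    intro r hr
    rw [hrs, List.mem_ofFn] at hr
    obtain ⟨i, rfl⟩ := hr
    rw [Ideal.annihilator_quotient]
    simpa using hJ i
  have h3 : rs.length = ℓ := by simp [hrs]
  rcases Nat.eq_zero_or_pos p with rfl | hp0
  · let φ : Poly ℓ →ₗ[Poly ℓ] A.relForms 0 :=
      (LinearMap.toSpanSingleton (Poly ℓ) (RatForm ℓ) 1).codRestrict _ A.smul_one_mem_relForms
    have hφ : Function.Bijective φ := by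
      constructor
      · intro a b hab
        have h4 : a • (1 : RatForm ℓ) = b • 1 := congrArg Subtype.val hab
        rw [← algebraMap_smul (RatFun ℓ) a, ← algebraMap_smul (RatFun ℓ) b] at h4
        exact IsFractionRing.injective (Poly ℓ) (RatFun ℓ)
          (smul_left_injective (RatFun ℓ) (one_ne_zero (α := RatForm ℓ)) h4)
      · rintro ⟨w, hw⟩
        obtain ⟨r, hr⟩ := A.exists_smul_one_of_mem_logForms_zero hw.1
        exact ⟨r, Subtype.ext hr⟩
    exact (ExtVanishes.of_flat rs h1 h2 (by omega)).of_equiv (LinearEquiv.ofBijective φ hφ).symm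
  · have h4 : ExtVanishes (R := Poly ℓ) (Poly ℓ ⧸ J) (A.logForms p) j :=
      ExtVanishes.of_hasProjectiveDimensionLE rs h1 h2 (htame p hp0 hp) (by omega)
    let ρ : A.logForms p →ₗ[Poly ℓ] A.relForms p :=
      ((((contract (euler ℓ)).restrictScalars (Poly ℓ)).comp
        (LinearMap.mulLeft (Poly ℓ) (A.dlog H₀))).comp (A.logForms p).subtype).codRestrict _
        fun w => A.contract_euler_dlog_mul_mem_relForms H₀ w.2
    exact h4.of_retract (Submodule.inclusion (inf_le_left : A.relForms p ≤ A.logForms p)) ρ fun w =>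
      Subtype.ext (A.contract_euler_dlog_mul_of_mem_relForms H₀ w.2)

/-- The ideal of the polynomials annihilating the cohomology in degree `p`. -/
def cohomologyAnnihilator (lam : Fin n → ℂ) (p : ℕ) : Ideal (Poly ℓ) where
  carrier := {r | ∀ z ∈ A.cocycles lam p, r • z ∈ A.coboundaries lam p}
  zero_mem' := fun z _ => by rw [zero_smul]; exact zero_mem _
  add_mem' := fun ha hb z hz => by rw [add_smul]; exact add_mem (ha z hz) (hb z hz)
  smul_mem' := fun c _ ha z hz => by rw [smul_assoc]; exact Submodule.smul_mem _ _ (ha z hz)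

open Classical in
/-- The cohomology vanishes below the top degree. -/
theorem mem_coboundaries_of_lt (hess : A.Essential) (htame : A.AlmostTame) (H₀ : Fin n)
    {lam : Fin n → ℂ} (hlam : ∑ H, lam H = 0)
    (hsum : ∀ S : Finset (Fin n), S.Nonempty → S ≠ Finset.univ → ∑ H ∈ S, lam H ≠ 0)
    (hnd : ∀ v, A.IsCritical lam v → A.IsNondegenerateAt lam v) :
    ∀ p < ℓ - 1, ∀ z ∈ A.relForms p, A.omega lam * z = 0 → z ∈ A.coboundaries lam p := by
  have hpt : ∀ p, p + 1 < ℓ → ∀ v : Fin ℓ → ℂ, v ≠ 0 →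
      ∃ r ∈ A.cohomologyAnnihilator lam p, MvPolynomial.eval v r ≠ 0 := by
    intro p hp v hv
    have hI : (∃ r ∈ A.ideal lam, MvPolynomial.eval v r ≠ 0) →
        ∃ r ∈ A.cohomologyAnnihilator lam p, MvPolynomial.eval v r ≠ 0 := by
      rintro ⟨r, hr, hrv⟩
      exact ⟨r, fun z hz => A.smul_mem_coboundaries hr hz.1 hz.2, hrv⟩
    by_cases hM : ∀ H, A.eval H v ≠ 0
    · by_cases hc : A.IsCritical lam v
      · obtain ⟨r, hr, hrz⟩ :=
          A.exists_smul_mem_coboundaries_of_isCritical hlam hc (hnd v hc) H₀ hv hp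
        exact ⟨r, hrz, hr⟩
      · exact hI (A.exists_mem_ideal_of_not_isCritical hM hc)
    · push Not at hM
      obtain ⟨H, hH⟩ := hM
      -- The hyperplanes through $v\ne0$ form a proper subset because the arrangement is essential.
      refine hI (A.exists_mem_ideal_of_sum_ne_zero (hsum _ ⟨H, by simp [hH]⟩ fun hu => ?_))
      refine hv (hess.eq_zero fun H' => ?_)
      have := Finset.mem_univ H'
      rw [← hu] at this
      exact (Finset.mem_filter.mp this).2
  have hpow : ∀ p, p + 1 < ℓ → ∀ i, ∃ k, (X i : Poly ℓ) ^ k ∈ A.cohomologyAnnihilator lam p := by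
    intro p hp i
    -- Nullstellensatz: the annihilator has no zero other than the origin.
    change X i ∈ (A.cohomologyAnnihilator lam p).radical
    rw [← MvPolynomial.vanishingIdeal_zeroLocus_eq_radical (K := ℂ), mem_vanishingIdeal_iff]
    intro v hv
    have hv0 : v = 0 := by
      by_contra hne
      obtain ⟨r, hr, hrv⟩ := hpt p hp v hne
      exact hrv (by simpa [MvPolynomial.aeval_eq_eval] using hv r hr)
    simp [hv0]
  let J : Ideal (Poly ℓ) := ⨅ p : Fin (ℓ - 1), A.cohomologyAnnihilator lam p
  have hJ : ∀ i, ∃ k, (X i : Poly ℓ) ^ k ∈ J := by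
    intro i
    choose k hk using fun p : Fin (ℓ - 1) => hpow p (by omega) i
    refine ⟨∑ p, k p, ?_⟩
    rw [Submodule.mem_iInf]
    intro p
    exact Ideal.pow_mem_of_pow_mem _ (hk p) (Finset.single_le_sum (fun _ _ => Nat.zero_le _)
      (Finset.mem_univ p))
  simp only [coboundaries_eq_boundaries]
  refine mem_boundaries_of_extVanishes A.relForms (LinearMap.mulLeft (Poly ℓ) (A.omega lam))
    ?_ ?_ J (ℓ - 1) ?_ ?_
  · exact fun p x hx => A.omega_mul_mem_relForms hlam hx
  · intro x
    rw [LinearMap.mulLeft_apply, LinearMap.mulLeft_apply, ← mul_assoc, omega_mul_self, zero_mul]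
  · exact fun p j hj => A.extVanishes_relForms H₀ htame J hJ (by omega) (by omega)
  · intro p hp z hz hωz r hr
    rw [← coboundaries_eq_boundaries]
    exact (Submodule.mem_iInf _).mp hr ⟨p, hp⟩ z ⟨hz, hωz⟩

/-- The vanishing of the cohomology outside of degree `ℓ - 1`. -/
theorem subsingleton_cohomology (hess : A.Essential) (htame : A.AlmostTame) (H₀ : Fin n)
    {lam : Fin n → ℂ} (hlam : ∑ H, lam H = 0)
    (hsum : ∀ S : Finset (Fin n), S.Nonempty → S ≠ Finset.univ → ∑ H ∈ S, lam H ≠ 0)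
    (hnd : ∀ v, A.IsCritical lam v → A.IsNondegenerateAt lam v) {p : ℕ} (hp : p ≠ ℓ - 1) :
    Subsingleton (A.Cohomology lam p) := by
  rw [subsingleton_cohomology_iff]
  intro z hz hωz
  rcases lt_or_gt_of_ne hp with h | h
  · exact A.mem_coboundaries_of_lt hess htame H₀ hlam hsum hnd p h z hz hωz
  · rw [A.relForms_eq_bot H₀ (by omega)] at hz
    rw [(Submodule.mem_bot _).mp hz]
    exact zero_mem _

end Arrangement

end LogForms

/-! ### Extending derivations and eliminating variables. -/

section Elimination

open MvPolynomial

open scoped TensorProduct in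
/-- Derivations extend along formally étale algebras. -/
lemma Derivation.exists_extension_of_formallyEtale {k P L : Type*} [CommRing k] [CommRing P]
    [CommRing L] [Algebra k P] [Algebra P L] [Algebra k L] [IsScalarTower k P L]
    [Algebra.FormallyEtale P L] (D : Derivation k P P) :
    ∃ D' : Derivation k L L, ∀ p, D' (algebraMap P L p) = algebraMap P L (D p) := by
  let D₀ : Derivation k P L := (Algebra.linearMap P L).compDer D
  let φ : L ⊗[P] Ω[P⁄k] →ₗ[L] L := D₀.liftKaehlerDifferential.liftBaseChange L
  let e := KaehlerDifferential.tensorKaehlerEquivOfFormallyEtale k P L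
  refine ⟨(φ.comp e.symm.toLinearMap).compDer (KaehlerDifferential.D k L), fun p => ?_⟩
  change φ (e.symm (KaehlerDifferential.D k L (algebraMap P L p))) = _
  rw [KaehlerDifferential.tensorKaehlerEquivOfFormallyEtale_symm_D_algebraMap]
  simp [φ, D₀]

/-- A system of polynomial equations with parameters `X_j` either has no solution outside of a
hypersurface of the parameter space, or it has a solution in a field where the parameters are
independent, in the sense that all `∂/∂X_k` extend to derivations. -/
lemma MvPolynomial.exists_C_mem_or_exists_generic_zero {k ι σ : Type} [Field k] [CharZero k]
    [Finite ι] [Finite σ] [DecidableEq ι] (I : Ideal (MvPolynomial σ (MvPolynomial ι k))) :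
    (∃ g : MvPolynomial ι k, g ≠ 0 ∧ C g ∈ I) ∨
    ∃ (L : Type) (_ : Field L) (_ : Algebra k L) (φ : MvPolynomial ι k →ₐ[k] L) (y : σ → L)
      (D : ι → Derivation k L L), (∀ i j, D i (φ (X j)) = if j = i then 1 else 0) ∧
      ∀ e ∈ I, eval₂Hom φ.toRingHom y e = 0 := by
  let P := MvPolynomial ι k
  let K := FractionRing P
  let : Algebra (MvPolynomial σ P) (MvPolynomial σ K) := MvPolynomial.algebraMvPolynomial
  let M := (nonZeroDivisors P).map (C (σ := σ))
  -- Either $I$ contains a nonzero polynomial in the parameters, or it remains proper over their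
  -- fraction field $K$. A residue field there is finite over $K$ by Zariski's lemma, and separable
  -- in characteristic $0$, so derivations extend to it.
  by_cases hdisj : Disjoint (M : Set (MvPolynomial σ P)) (I : Set (MvPolynomial σ P))
  · right
    have htop : I.map (algebraMap (MvPolynomial σ P) (MvPolynomial σ K)) ≠ ⊤ :=
      (IsLocalization.map_algebraMap_ne_top_iff_disjoint M (MvPolynomial σ K) I).mpr hdisj
    obtain ⟨m, hm, hle⟩ := Ideal.exists_le_maximal _ htop
    let L := MvPolynomial σ K ⧸ m
    let : Field L := Ideal.Quotient.field m
    have : Module.Finite K L := finite_of_finite_type_of_isJacobsonRing K L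
    have : CharZero P := inferInstance
    have : CharZero K := inferInstance
    have : Algebra.FormallyEtale K L := Algebra.FormallyEtale.of_isSeparable K L
    have : Algebra.FormallyEtale P K := Algebra.FormallyEtale.of_isLocalization (nonZeroDivisors P)
    have : Algebra.FormallyEtale P L := Algebra.FormallyEtale.comp P K L
    choose D hD using fun i : ι => Derivation.exists_extension_of_formallyEtale (k := k) (L := L)
      (pderiv i : Derivation k P P)
    refine ⟨L, inferInstance, inferInstance, IsScalarTower.toAlgHom k P L,
      fun s => Ideal.Quotient.mk m (X s), D, ?_, ?_⟩
    · intro i j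
      have h1 := hD i (X j)
      rw [pderiv_X, Pi.single_apply] at h1
      refine h1.trans ?_
      split_ifs <;> simp
    · intro e he
      have h1 : (eval₂Hom (IsScalarTower.toAlgHom k P L).toRingHom
          fun s => Ideal.Quotient.mk m (X s)) =
          (Ideal.Quotient.mk m).comp (algebraMap (MvPolynomial σ P) (MvPolynomial σ K)) := by
        refine MvPolynomial.ringHom_ext (fun p => ?_) fun s => ?_
        · rw [coe_eval₂Hom, eval₂_C, RingHom.comp_apply, MvPolynomial.algebraMap_def, map_C]
          rfl
        · rw [coe_eval₂Hom, eval₂_X, RingHom.comp_apply, MvPolynomial.algebraMap_def, map_X]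
      rw [h1, RingHom.comp_apply, Ideal.Quotient.eq_zero_iff_mem]
      exact hle (Ideal.mem_map_of_mem _ he)
  · left
    rw [Set.not_disjoint_iff] at hdisj
    obtain ⟨_, ⟨g, hg, rfl⟩, hgI⟩ := hdisj
    exact ⟨g, nonZeroDivisors.ne_zero hg, hgI⟩

end Elimination

/-! ### Generic nondegeneracy of critical points. -/

namespace LogForms

open MvPolynomial

variable {ℓ n : ℕ}

namespace Arrangement

variable (A : Arrangement ℓ n)

/-- `v` is a critical point of the master function with values in the algebra `B`, the Hessian
has `a` in its kernel, `u_H = α_H(v)⁻¹` and `t = (a_i v_j - a_j v_i)⁻¹`. -/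
structure IsDegenerateSolution {B : Type} [CommRing B] [Algebra ℂ B] (i j : Fin ℓ)
    (lam : Fin n → B) (v a : Fin ℓ → B) (u : Fin n → B) (t : B) : Prop where
  inv : ∀ H, u H * (∑ k, algebraMap ℂ B (A.coeff H k) * v k) - 1 = 0
  crit : ∀ m, ∑ H, lam H * algebraMap ℂ B (A.coeff H m) * u H = 0
  hess : ∀ m, ∑ H, lam H * algebraMap ℂ B (A.coeff H m) *
    (∑ k, algebraMap ℂ B (A.coeff H k) * a k) * u H ^ 2 = 0
  indep : (a i * v j - a j * v i) * t - 1 = 0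

variable {A}

lemma Essential.exists_sum (hess : A.Essential) (i : Fin ℓ) :
    ∃ b : Fin n → ℂ, ∀ k, ∑ H, b H * A.coeff H k = if k = i then 1 else 0 := by
  have h : Pi.single i 1 ∈ Submodule.span ℂ (Set.range A.coeff) := by rw [hess]; trivial
  obtain ⟨b, hb⟩ := (Submodule.mem_span_range_iff_exists_fun ℂ).mp h
  refine ⟨b, fun k => ?_⟩
  have := congrFun hb k
  simpa [Pi.single_apply] using this

/-- A form of generic smoothness: there is no degenerate critical point over a field where the
parameters `λ` are independent in the hyperplane `|λ| = 0`. -/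
lemma IsDegenerateSolution.false_of_derivation (hess : A.Essential) {L : Type} [Field L]
    [Algebra ℂ L] {i j : Fin ℓ} {lam : Fin n → L} {v a : Fin ℓ → L} {u : Fin n → L} {t : L}
    (h : A.IsDegenerateSolution i j lam v a u t) (s : L) (D : Fin n → Derivation ℂ L L)
    (hD : ∀ k H, D k (lam H) = (if H = k then 1 else 0) - s) : False := by
  set α : Fin n → (Fin ℓ → L) → L := fun H x => ∑ k, algebraMap ℂ L (A.coeff H k) * x k with hα
  have hinv : ∀ H, u H * α H v = 1 := fun H => sub_eq_zero.mp (h.inv H)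
  have hDα : ∀ k H, D k (α H v) = α H (fun m => D k (v m)) := by
    intro k H
    simp [hα, map_sum, Derivation.leibniz]
  have hDu : ∀ k H, D k (u H) = -(u H ^ 2 * α H (fun m => D k (v m))) := by
    intro k H
    have h1 := congrArg (D k) (hinv H)
    rw [Derivation.leibniz, hDα, Derivation.map_one_eq_zero, smul_eq_mul, smul_eq_mul] at h1
    have h2 := hinv H
    linear_combination u H * h1 - D k (u H) * h2
  -- Apply $D_k$ to the critical equations and pair with $a$. The terms containing $D_kv$ form the
  -- Hessian paired with $a$ and vanish; only $D_k\lambda_H$ contributes.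
  have hβ : ∀ k, α k a * u k = s * ∑ H, α H a * u H := by
    intro k
    have h1 : ∀ m, ∑ H, ((D k (lam H)) * algebraMap ℂ L (A.coeff H m) * u H -
        lam H * algebraMap ℂ L (A.coeff H m) * (u H ^ 2 * α H (fun m => D k (v m)))) = 0 := by
      intro m
      have h2 := congrArg (D k) (h.crit m)
      rw [map_sum, map_zero] at h2
      rw [← h2]
      refine Finset.sum_congr rfl fun H _ => ?_
      rw [Derivation.leibniz, Derivation.leibniz, hDu, Derivation.map_algebraMap]
      simp only [smul_eq_mul]
      ring
    have h3 : ∑ m, a m * ∑ H, ((D k (lam H)) * algebraMap ℂ L (A.coeff H m) * u H -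
        lam H * algebraMap ℂ L (A.coeff H m) * (u H ^ 2 * α H (fun m => D k (v m)))) = 0 := by
      simp [h1]
    have h4 : ∑ m, D k (v m) * ∑ H, lam H * algebraMap ℂ L (A.coeff H m) * α H a * u H ^ 2 = 0 := by
      have h5 := h.hess
      exact Finset.sum_eq_zero fun m _ => by rw [h5 m, mul_zero]
    have h6 : ∑ m, a m * ∑ H, ((D k (lam H)) * algebraMap ℂ L (A.coeff H m) * u H -
        lam H * algebraMap ℂ L (A.coeff H m) * (u H ^ 2 * α H (fun m => D k (v m)))) =
        ∑ H, D k (lam H) * (α H a * u H) -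
          ∑ H, lam H * α H a * u H ^ 2 * α H (fun m => D k (v m)) := by
      simp only [Finset.mul_sum]
      rw [Finset.sum_comm, ← Finset.sum_sub_distrib]
      refine Finset.sum_congr rfl fun H _ => ?_
      rw [show α H a = ∑ m, algebraMap ℂ L (A.coeff H m) * a m from rfl]
      simp only [Finset.mul_sum, Finset.sum_mul]
      rw [← Finset.sum_sub_distrib]
      exact Finset.sum_congr rfl fun m _ => by ring
    have h7 : ∑ H, lam H * α H a * u H ^ 2 * α H (fun m => D k (v m)) = 0 := by
      rw [← h4]
      simp only [Finset.mul_sum]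
      rw [Finset.sum_comm]
      refine Finset.sum_congr rfl fun H _ => ?_
      rw [show α H (fun m => D k (v m)) = ∑ m, algebraMap ℂ L (A.coeff H m) * D k (v m) from rfl,
        Finset.mul_sum]
      exact Finset.sum_congr rfl fun m _ => by ring
    rw [h6, h7, sub_zero] at h3
    simp only [hD, sub_mul, ite_mul, one_mul, zero_mul, Finset.sum_sub_distrib,
      Finset.sum_ite_eq', Finset.mem_univ, if_true] at h3
    rw [sub_eq_zero.mp h3, Finset.mul_sum]
  -- The constant does not depend on the hyperplane, so $\alpha_H(a)=c\,\alpha_H(v)$ for all $H$;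
  -- essentiality turns this into $a=cv$, against the nonzero minor.
  set c := s * ∑ H, α H a * u H with hc
  have hαa : ∀ H, α H a = c * α H v := by
    intro H
    linear_combination α H v * hβ H - α H a * hinv H
  have hacv : ∀ m, a m = c * v m := by
    intro m
    obtain ⟨b, hb⟩ := hess.exists_sum m
    have h1 : ∀ x : Fin ℓ → L, x m = ∑ H, algebraMap ℂ L (b H) * α H x := by
      intro x
      simp only [hα, Finset.mul_sum]
      rw [Finset.sum_comm]
      simp only [← mul_assoc, ← Finset.sum_mul, ← map_mul, ← map_sum, hb]
      simp
    rw [h1 a, h1 v, Finset.mul_sum]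
    exact Finset.sum_congr rfl fun H _ => by rw [hαa]; ring
  have := h.indep
  rw [hacv i, hacv j] at this
  apply one_ne_zero (α := L)
  linear_combination -this

end Arrangement

end LogForms

/-! ### The degenerate locus and isolated critical points. -/

namespace LogForms

open MvPolynomial

variable {ℓ n : ℕ}

namespace Arrangement

variable (A : Arrangement ℓ n)

/-- The generic point of the hyperplane `|λ| = 0`. -/
def genericWeight (n : ℕ) (H : Fin n) : MvPolynomial (Fin n) ℂ :=
  X H - C ((n : ℂ)⁻¹) * ∑ H', X H'

lemma eval_genericWeight (μ : Fin n → ℂ) (H : Fin n) :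
    MvPolynomial.eval μ (genericWeight n H) = μ H - (n : ℂ)⁻¹ * ∑ H', μ H' := by
  simp [genericWeight]

/-- The ideal of the equations for degenerate critical points, with coordinates for `v`, `a`, `u`
and `t`. -/
def degenerateIdeal (i j : Fin ℓ) : Ideal
    (MvPolynomial ((Fin ℓ ⊕ Fin ℓ) ⊕ (Fin n ⊕ Unit)) (MvPolynomial (Fin n) ℂ)) :=
  Ideal.span
    (Set.range (fun H => X (.inr (.inl H)) *
      (∑ k, algebraMap ℂ _ (A.coeff H k) * X (.inl (.inl k))) - 1)
    ∪ Set.range (fun m => ∑ H, C (genericWeight n H) * algebraMap ℂ _ (A.coeff H m) *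
        X (.inr (.inl H)))
    ∪ Set.range (fun m => ∑ H, C (genericWeight n H) * algebraMap ℂ _ (A.coeff H m) *
        (∑ k, algebraMap ℂ _ (A.coeff H k) * X (.inl (.inr k))) * X (.inr (.inl H)) ^ 2)
    ∪ {(X (.inl (.inr i)) * X (.inl (.inl j)) - X (.inl (.inr j)) * X (.inl (.inl i))) *
        X (.inr (.inr ())) - 1})

lemma forall_mem_degenerateIdeal_iff {B : Type} [CommRing B] [Algebra ℂ B] (i j : Fin ℓ)
    (φ : MvPolynomial (Fin n) ℂ →ₐ[ℂ] B) (y : (Fin ℓ ⊕ Fin ℓ) ⊕ (Fin n ⊕ Unit) → B) :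
    (∀ e ∈ A.degenerateIdeal i j, eval₂Hom φ.toRingHom y e = 0) ↔
      A.IsDegenerateSolution i j (fun H => φ (genericWeight n H)) (fun k => y (.inl (.inl k)))
        (fun k => y (.inl (.inr k))) (fun H => y (.inr (.inl H))) (y (.inr (.inr ()))) := by
  have hc : ∀ c : ℂ, eval₂Hom φ.toRingHom y (algebraMap ℂ _ c) = algebraMap ℂ B c := by
    intro c
    rw [IsScalarTower.algebraMap_apply ℂ (MvPolynomial (Fin n) ℂ), MvPolynomial.algebraMap_eq,
      coe_eval₂Hom, eval₂_C]
    exact φ.commutes c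
  have hw : ∀ g, eval₂Hom φ.toRingHom y (C g) = φ g := fun g => by
    rw [coe_eval₂Hom, eval₂_C]; rfl
  have hX : ∀ s, eval₂Hom φ.toRingHom y (X s) = y s := fun s => by
    rw [coe_eval₂Hom, eval₂_X]
  constructor
  · intro h
    refine ⟨fun H => ?_, fun m => ?_, fun m => ?_, ?_⟩
    · have := h _ (Ideal.subset_span (Or.inl (Or.inl (Or.inl ⟨H, rfl⟩))))
      simpa only [map_sub, map_mul, map_sum, map_one, hc, hX] using this
    · have := h _ (Ideal.subset_span (Or.inl (Or.inl (Or.inr ⟨m, rfl⟩))))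
      simpa only [map_mul, map_sum, hc, hX, hw] using this
    · have := h _ (Ideal.subset_span (Or.inl (Or.inr ⟨m, rfl⟩)))
      simpa only [map_mul, map_sum, map_pow, hc, hX, hw] using this
    · have := h _ (Ideal.subset_span (Or.inr rfl))
      simpa only [map_sub, map_mul, map_one, hX] using this
  · intro h
    suffices A.degenerateIdeal i j ≤ RingHom.ker (eval₂Hom φ.toRingHom y) from fun e he => this he
    refine Ideal.span_le.mpr ?_
    rintro e (((⟨H, rfl⟩ | ⟨m, rfl⟩) | ⟨m, rfl⟩) | rfl)
    all_goals rw [SetLike.mem_coe, RingHom.mem_ker]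
    · simpa only [map_sub, map_mul, map_sum, map_one, hc, hX] using h.inv H
    · simpa only [map_mul, map_sum, hc, hX, hw] using h.crit m
    · simpa only [map_mul, map_sum, map_pow, hc, hX, hw] using h.hess m
    · simpa only [map_sub, map_mul, map_one, hX] using h.indep

variable {A}

/-- Over a general point of the hyperplane `|λ| = 0` there is no degenerate critical point. -/
lemma Essential.exists_isDegenerateSolution_locus (hess : A.Essential) (i j : Fin ℓ) :
    ∃ g : MvPolynomial (Fin n) ℂ, g ≠ 0 ∧ ∀ (μ : Fin n → ℂ) (v a : Fin ℓ → ℂ) (u : Fin n → ℂ)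
      (t : ℂ), A.IsDegenerateSolution i j (fun H => μ H - (n : ℂ)⁻¹ * ∑ H', μ H') v a u t →
        MvPolynomial.eval μ g = 0 := by
  rcases exists_C_mem_or_exists_generic_zero (A.degenerateIdeal i j) with
    ⟨g, hg, hgI⟩ | ⟨L, _, _, φ, y, D, hD, hy⟩
  · refine ⟨g, hg, fun μ v a u t h => ?_⟩
    have := (A.forall_mem_degenerateIdeal_iff i j (aeval μ)
      (Sum.elim (Sum.elim v a) (Sum.elim u fun _ => t))).mpr (by
        simp only [aeval_eq_eval, eval_genericWeight]
        exact h) _ hgI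
    rw [coe_eval₂Hom, eval₂_C] at this
    exact this
  · have h := (A.forall_mem_degenerateIdeal_iff i j φ y).mp hy
    -- The derivative of $\lambda_H=X_H-\frac1n\sum X_{H'}$ along $X_k$ is $\delta_{Hk}-\frac1n$,
    -- hence $s=\frac1n$.
    refine (h.false_of_derivation hess (algebraMap ℂ L (n : ℂ)⁻¹) D fun k H => ?_).elim
    have hs : ∑ H', D k (φ (X H')) = 1 := by simp [hD]
    have hC : φ (C ((n : ℂ)⁻¹)) = algebraMap ℂ L (n : ℂ)⁻¹ := φ.commutes _
    rw [genericWeight, map_sub, map_mul, map_sum, hC, map_sub, hD, Derivation.leibniz, map_sum, hs,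
      Derivation.map_algebraMap, smul_zero, add_zero, smul_eq_mul, mul_one]

/-- A Hessian kernel vector off the line $\mathbb Cv$ has a nonzero minor with $v$; inverting it and
the $\alpha_H(v)$ completes a degenerate solution. -/
lemma isNondegenerateAt_of_forall {lam : Fin n → ℂ} {v : Fin ℓ → ℂ} (hv0 : v ≠ 0)
    (hcrit : A.IsCritical lam v)
    (h : ∀ i j a u t, ¬ A.IsDegenerateSolution i j lam v a u t) : A.IsNondegenerateAt lam v := by
  intro a ha
  obtain ⟨j, hj⟩ : ∃ j, v j ≠ 0 := by
    by_contra! h'; exact hv0 (funext h')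
  rw [Submodule.mem_span_singleton]
  refine ⟨a j / v j, ?_⟩
  funext i
  by_contra hne
  have hij : a i * v j - a j * v i ≠ 0 := by
    intro h0
    apply hne
    rw [Pi.smul_apply, smul_eq_mul]
    field_simp
    linear_combination -h0
  refine h i j a (fun H => (A.eval H v)⁻¹) (a i * v j - a j * v i)⁻¹ ⟨fun H => ?_, fun m => ?_,
    fun m => ?_, ?_⟩
  · change (A.eval H v)⁻¹ * A.eval H v - 1 = 0
    rw [inv_mul_cancel₀ (hcrit.1 H), sub_self]
  · rw [← hcrit.sum_coeff m]
    exact Finset.sum_congr rfl fun H _ => by rw [Algebra.algebraMap_self_apply]; ring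
  · rw [← ha (Pi.single m 1)]
    refine Finset.sum_congr rfl fun H _ => ?_
    change lam H * A.coeff H m * A.eval H a * (A.eval H v)⁻¹ ^ 2 = _
    rw [eval_single]
    ring
  · rw [mul_inv_cancel₀ hij, sub_self]

lemma continuous_eval (H : Fin n) : Continuous (A.eval H) := by
  unfold Arrangement.eval
  fun_prop

lemma eval_sum_single (H : Fin n) (b : Fin ℓ → ℂ) : A.eval H b = ∑ i, b i * A.coeff H i := by
  rw [Arrangement.eval]
  exact Finset.sum_congr rfl fun i _ => mul_comm _ _

/-- Nondegenerate critical points are isolated in `ℙV`. -/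
lemma IsNondegenerateAt.isIsolatedCritical {lam : Fin n → ℂ} {v : Fin ℓ → ℂ} (hv0 : v ≠ 0)
    (hcrit : A.IsCritical lam v) (hnd : A.IsNondegenerateAt lam v) :
    A.IsIsolatedCritical lam v := by
  obtain ⟨j, hj⟩ : ∃ j, v j ≠ 0 := by
    by_contra! h'; exact hv0 (funext h')
  -- The sum is a polarized Hessian: if $v$ and $w$ are both critical, it kills both. The extra
  -- entry at $(j,j)$ makes $M(v)$ invertible, hence also $M(w)$ for $w$ near $v$, while $M(w)$
  -- kills $(w_j/v_j)v-w$.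
  let M : (Fin ℓ → ℂ) → Matrix (Fin ℓ) (Fin ℓ) ℂ := fun w i k =>
    ∑ H, lam H * (A.coeff H i * A.coeff H k / (A.eval H v * A.eval H w)) +
      if i = j ∧ k = j then 1 else 0
  have hM : ∀ w b i, (M w).mulVec b i =
      ∑ H, lam H * (A.coeff H i * A.eval H b / (A.eval H v * A.eval H w)) +
        if i = j then b j else 0 := by
    intro w b i
    simp only [M, Matrix.mulVec, dotProduct, add_mul, Finset.sum_add_distrib]
    congr 1
    · simp only [Finset.sum_mul]
      rw [Finset.sum_comm]
      refine Finset.sum_congr rfl fun H _ => ?_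
      rw [show A.eval H b = ∑ k, A.coeff H k * b k from rfl, Finset.mul_sum, Finset.sum_div,
        Finset.mul_sum]
      exact Finset.sum_congr rfl fun k _ => by ring
    · by_cases hi : i = j <;> simp [hi]
  have hcont : ContinuousAt (fun w => (M w).det) v := by
    refine ContinuousAt.comp (g := Matrix.det) (Continuous.continuousAt (by fun_prop)) ?_
    refine continuousAt_pi.mpr fun i => continuousAt_pi.mpr fun k => ?_
    refine ContinuousAt.add (tendsto_finsetSum _ fun H _ => ?_) continuousAt_const
    refine ContinuousAt.mul continuousAt_const (ContinuousAt.div continuousAt_const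
      (continuousAt_const.mul (continuous_eval H).continuousAt) ?_)
    exact mul_ne_zero (hcrit.1 H) (hcrit.1 H)
  have hker : ∀ b, (∀ i, ∑ H, lam H * (A.coeff H i * A.eval H b / (A.eval H v * A.eval H v)) = 0) →
      b ∈ Submodule.span ℂ {v} := by
    intro b hb
    refine hnd b fun c => ?_
    have : ∀ H, lam H * (A.eval H b * A.eval H c / A.eval H v ^ 2) =
        ∑ i, c i * (lam H * (A.coeff H i * A.eval H b / (A.eval H v * A.eval H v))) := by
      intro H
      rw [eval_sum_single H c, Finset.mul_sum, Finset.sum_div, Finset.mul_sum]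
      exact Finset.sum_congr rfl fun i _ => by ring
    simp only [this]
    rw [Finset.sum_comm]
    simp only [← Finset.mul_sum, hb, mul_zero, Finset.sum_const_zero]
  have hdet : (M v).det ≠ 0 := by
    intro h0
    obtain ⟨b, hb0, hb⟩ := Matrix.exists_mulVec_eq_zero_iff.mpr h0
    have hbi : ∀ i, ∑ H, lam H * (A.coeff H i * A.eval H b / (A.eval H v * A.eval H v)) +
        (if i = j then b j else 0) = 0 := fun i => by rw [← hM]; exact congrFun hb i
    -- Pairing with $v$ removes the Hessian part and leaves $v_jb_j=0$.
    have hbj : b j = 0 := by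
      have h1 : ∑ i, v i * (∑ H, lam H * (A.coeff H i * A.eval H b / (A.eval H v * A.eval H v)) +
          (if i = j then b j else 0)) = 0 := by simp [hbi]
      simp only [mul_add, Finset.sum_add_distrib, mul_ite, mul_zero, Finset.sum_ite_eq',
        Finset.mem_univ, if_true] at h1
      have h2 : ∑ i, v i * ∑ H, lam H * (A.coeff H i * A.eval H b / (A.eval H v * A.eval H v)) =
          0 := by
        rw [← hcrit.2 b]
        simp only [Finset.mul_sum]
        rw [Finset.sum_comm]
        refine Finset.sum_congr rfl fun H _ => ?_
        have h3 : ∀ i, v i * (lam H * (A.coeff H i * A.eval H b / (A.eval H v * A.eval H v))) =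
            v i * A.coeff H i * (lam H * A.eval H b / (A.eval H v * A.eval H v)) := fun i => by ring
        simp only [h3]
        rw [← Finset.sum_mul, ← eval_sum_single]
        have := hcrit.1 H
        field_simp
      rw [h2, zero_add] at h1
      exact (mul_eq_zero.mp h1).resolve_left hj
    obtain ⟨c, rfl⟩ := Submodule.mem_span_singleton.mp (hker b fun i => by
      have := hbi i
      rwa [hbj, ite_self, add_zero] at this)
    have hc : c = 0 := (mul_eq_zero.mp hbj).resolve_right hj
    exact hb0 (by rw [hc, zero_smul])
  filter_upwards [hcont.eventually_ne hdet] with w hw hwc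
  rw [Submodule.mem_span_singleton]
  refine ⟨w j / v j, ?_⟩
  have hMv : ∀ i, ∑ H, lam H * (A.coeff H i * A.eval H v / (A.eval H v * A.eval H w)) = 0 := by
    intro i
    rw [← hwc.sum_coeff i]
    refine Finset.sum_congr rfl fun H _ => ?_
    have h1 := hcrit.1 H
    have h2 := hwc.1 H
    field_simp
  have hMw : ∀ i, ∑ H, lam H * (A.coeff H i * A.eval H w / (A.eval H v * A.eval H w)) = 0 := by
    intro i
    rw [← hcrit.sum_coeff i]
    refine Finset.sum_congr rfl fun H _ => ?_
    have h1 := hcrit.1 H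
    have h2 := hwc.1 H
    field_simp
  by_contra hne
  refine hw (Matrix.exists_mulVec_eq_zero_iff.mp ⟨(w j / v j) • v - w, sub_ne_zero.mpr hne, ?_⟩)
  funext i
  rw [Matrix.mulVec_sub, Matrix.mulVec_smul, Pi.sub_apply, Pi.smul_apply, hM, hM, hMv, hMw]
  by_cases hi : i = j
  · simp [hi, hj]
  · simp [hi]

end Arrangement

end LogForms

/-! ### The open set of weights, and the theorem. -/

namespace LogForms

open MvPolynomial

variable {ℓ n : ℕ}

/-- At the indicator function of $S$ the value is $|S|(1-|S|/n)$. -/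
lemma sum_genericWeight_ne_zero {S : Finset (Fin n)} (hS : S.Nonempty) (hS' : S ≠ Finset.univ) :
    ∑ H ∈ S, Arrangement.genericWeight n H ≠ 0 := by
  intro h
  have h1 := congrArg (MvPolynomial.eval fun H => if H ∈ S then (1 : ℂ) else 0) h
  have hn : (n : ℂ) ≠ 0 := by
    obtain ⟨H, -⟩ := hS
    exact_mod_cast (Nat.zero_lt_of_lt H.2).ne'
  simp only [map_sum, Arrangement.eval_genericWeight, Finset.sum_sub_distrib, Finset.sum_ite_mem,
    Finset.inter_self, Finset.univ_inter, Finset.sum_const, nsmul_eq_mul, mul_one, map_zero] at h1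
  have hS0 : (S.card : ℂ) ≠ 0 := by exact_mod_cast hS.card_pos.ne'
  field_simp at h1
  rw [mul_zero, mul_eq_zero, or_iff_right hS0, sub_eq_zero] at h1
  apply hS'
  rw [← Finset.card_eq_iff_eq_univ, Fintype.card_fin]
  exact_mod_cast h1.symm

/-- A nonzero polynomial defines a Zariski-open set that meets the hyperplane `|λ| = 0`, and that
contains a translate of `λ` only for points where the polynomial is nonzero. -/
lemma exists_isZariskiOpen_translate (hn : (n : ℂ) ≠ 0) {G : MvPolynomial (Fin n) ℂ}
    (hG : G ≠ 0) : ∃ Y : Set (Fin n → ℂ), IsZariskiOpen Y ∧ (∃ lam ∈ Y, ∑ H, lam H = 0) ∧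
      ∀ lam ∈ Y, ∑ H, lam H = 0 → ∃ μ : Fin n → ℂ, MvPolynomial.eval μ G ≠ 0 ∧
        ∀ H, μ H - (n : ℂ)⁻¹ * ∑ H', μ H' = lam H := by
  obtain ⟨μ₀, hμ₀⟩ : ∃ μ₀, MvPolynomial.eval μ₀ G ≠ 0 := by
    by_contra! h
    exact hG (MvPolynomial.funext fun x => by rw [h, map_zero])
  set s := (n : ℂ)⁻¹ * ∑ H, μ₀ H with hs
  have heval : ∀ lam : Fin n → ℂ, MvPolynomial.eval lam (aeval (fun H => X H + C s) G) =
      MvPolynomial.eval (fun H => lam H + s) G := by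
    intro lam
    have := comp_aeval_apply (fun H => X H + C s) (aeval lam : _ →ₐ[ℂ] ℂ) G
    simpa [aeval_eq_eval] using this
  -- Subtracting the mean is unaffected by translation along $(1,\dots,1)$. Translating $G$ by the
  -- mean $s$ of a point $\mu_0$ where $G\neq0$ brings such a point into the hyperplane.
  refine ⟨_, ⟨{aeval (fun H => X H + C s) G}, rfl⟩, ⟨fun H => μ₀ H - s, ⟨_, rfl, ?_⟩, ?_⟩, ?_⟩
  · rw [heval]
    simpa using hμ₀
  · rw [Finset.sum_sub_distrib, Finset.sum_const, Finset.card_univ, Fintype.card_fin, nsmul_eq_mul,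
      hs, mul_inv_cancel_left₀ hn, sub_self]
  · rintro lam ⟨_, rfl, h⟩ hlam
    rw [heval] at h
    refine ⟨_, h, fun H => ?_⟩
    rw [Finset.sum_add_distrib, hlam, Finset.sum_const, Finset.card_univ, Fintype.card_fin,
      nsmul_eq_mul, zero_add, inv_mul_cancel_left₀ hn, add_sub_cancel_right]

end LogForms

end

theorem mainTheorem6 {ℓ n : ℕ} (hℓ : 1 ≤ ℓ) (A : LogForms.Arrangement ℓ n)
    (hess : A.Essential) (htame : A.AlmostTame) :
    ∃ Y : Set (Fin n → ℂ), LogForms.IsZariskiOpen Y ∧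
      (∃ lam ∈ Y, ∑ H, lam H = 0) ∧
      ∀ lam ∈ Y, ∑ H, lam H = 0 →
        (∀ v, A.IsCritical lam v → A.IsIsolatedCritical lam v ∧ A.IsNondegenerateAt lam v) ∧
        (∀ p : ℕ, p ≠ ℓ - 1 → Subsingleton (A.Cohomology lam p)) ∧
        ∃ e : A.Cohomology lam (ℓ - 1) ≃ₗ[LogForms.Poly ℓ] (LogForms.Poly ℓ ⧸ A.ideal lam),
          ∀ j : ℤ, e '' A.cohomologyDeg lam (ℓ - 1) j =
            LogForms.quotDeg (A.ideal lam) (j + ((n : ℤ) - (ℓ : ℤ))) := by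
  -- With no hyperplanes every vector would be killed by all forms, which essentiality forbids since
  -- $\ell\ge1$.
  obtain ⟨H₀⟩ : Nonempty (Fin n) := by
    by_contra hn
    rw [not_nonempty_iff] at hn
    have := congrFun (hess.eq_zero (v := Pi.single ⟨0, hℓ⟩ 1) fun H => hn.elim H) ⟨0, hℓ⟩
    simp at this
  have hn : (n : ℂ) ≠ 0 := by exact_mod_cast (Nat.zero_lt_of_lt H₀.2).ne'
  choose g hg hgv using hess.exists_isDegenerateSolution_locus
  -- One polynomial collects all genericity conditions: one factor per minor of $(a,v)$ and one per
  -- proper nonempty partial sum.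
  have hprod : (∏ i, ∏ j, g i j) * ∏ S : {S : Finset (Fin n) // S.Nonempty ∧ S ≠ Finset.univ},
      ∑ H ∈ S.1, LogForms.Arrangement.genericWeight n H ≠ 0 :=
    mul_ne_zero (Finset.prod_ne_zero_iff.mpr fun i _ => Finset.prod_ne_zero_iff.mpr
      fun j _ => hg i j) (Finset.prod_ne_zero_iff.mpr fun S _ =>
        LogForms.sum_genericWeight_ne_zero S.2.1 S.2.2)
  obtain ⟨Y, hY, hmeet, hYG⟩ := LogForms.exists_isZariskiOpen_translate hn hprod
  refine ⟨Y, hY, hmeet, fun lam hlamY hlam => ?_⟩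
  obtain ⟨μ, hμ, hμlam⟩ := hYG lam hlamY hlam
  obtain rfl : (fun H => μ H - (n : ℂ)⁻¹ * ∑ H', μ H') = lam := funext hμlam
  rw [map_mul, map_prod, map_prod] at hμ
  obtain ⟨hμ1, hμ2⟩ := mul_ne_zero_iff.mp hμ
  have hsum : ∀ S : Finset (Fin n), S.Nonempty → S ≠ Finset.univ →
      ∑ H ∈ S, (μ H - (n : ℂ)⁻¹ * ∑ H', μ H') ≠ 0 := by
    intro S hS hS'
    have := Finset.prod_ne_zero_iff.mp hμ2 ⟨S, hS, hS'⟩ (Finset.mem_univ _)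
    simpa only [map_sum, LogForms.Arrangement.eval_genericWeight] using this
  have hv0 : ∀ v, A.IsCritical (fun H => μ H - (n : ℂ)⁻¹ * ∑ H', μ H') v → v ≠ 0 := by
    rintro _ hv rfl
    exact hv.1 H₀ (by simp [LogForms.Arrangement.eval])
  have hnd : ∀ v, A.IsCritical (fun H => μ H - (n : ℂ)⁻¹ * ∑ H', μ H') v →
      A.IsNondegenerateAt (fun H => μ H - (n : ℂ)⁻¹ * ∑ H', μ H') v := by
    intro v hv
    refine LogForms.Arrangement.isNondegenerateAt_of_forall (hv0 v hv) hv fun i j a u t h => ?_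
    have h1 := Finset.prod_ne_zero_iff.mp hμ1 i (Finset.mem_univ _)
    rw [map_prod] at h1
    exact Finset.prod_ne_zero_iff.mp h1 j (Finset.mem_univ _) (hgv i j μ v a u t h)
  refine ⟨fun v hv => ⟨(hnd v hv).isIsolatedCritical (hv0 v hv) hv, hnd v hv⟩, fun p hp =>
    A.subsingleton_cohomology hess htame H₀ hlam hsum hnd hp, ?_⟩
  exact A.exists_cohomology_top_equiv H₀ hlam (p := ℓ - 1) (by omega)
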